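/- A rooted graph $(G,o)$ is a connected, locally finite (simple) graph $G$ with a distinguished vertex $o$; let $\mathcal G_\bullet$ be the space of isomorphism classes of rooted graphs with the Borel $\sigma$-algebra of the local topology (two rooted graphs are close if large balls around their roots are isomorphic as rooted graphs), and let $\mathcal G_{\bullet\bullet}$ be the analogous space of graphs with an ordered pair of roots. A random rooted graph $(G,o)$, i.e. a random variable with values in $\mathcal G_\bullet$, is unimodular if $$\mathbb E\Big[\sum_{v\in V[G]}F(G,o,v)\Big]=\mathbb E\Big[\sum_{v\in V[G]}F(G,v,o)\Big]$$ for every Borel measurable $F:\mathcal G_{\bullet\bullet}\to[0,\infty)$. A graph $G$ has the infinite intersection property if for all vertices $u,v$ of $G$, two independent simple random walks $X$ and $Y$ on $G$ started at $u$ and $v$ almost surely satisfy $\#\{(i,j): i,j\ge 0,\ X_i=Y_j\}=\infty$. (On the graph with a single vertex the walk stays put.) **Proposition.** Let $(G,o)$ be a unimodular random rooted graph with $\mathbb E[\deg(o)^2]<\infty$. Let $X$ and $Y$ be two simple random walks on $G$, both started at $o$, that are conditionally independent given $(G,o)$. If $$\mathbb E\big[\#\{(i,j): i,j\ge 0,\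 X_i=Y_j\}\,\big|\,(G,o),Y\big]=\infty\qquad\text{almost surely},$$ then $G$ has the infinite intersection property almost surely. -/

import Mathlib

open MeasureTheory ProbabilityTheory
open scoped ENNReal NNReal

noncomputable section

/-! ### Simple random walk on a locally finite graph -/

namespace SimpleGraph

section Walk

variable {V W : Type*} [MeasurableSpace V] [DiscreteMeasurableSpace V]
  [MeasurableSpace W] [DiscreteMeasurableSpace W]

open Classical in
/-- The law of one step of simple random walk from `v`: uniform on the neighbours of `v`.
By convention the walk stays put at a vertex without neighbours (a connected graph has such a
vertex only if it consists of that single vertex). -/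
def stepLaw (G : SimpleGraph V) [G.LocallyFinite] (v : V) : PMF V :=
  if h : (G.neighborFinset v).Nonempty then PMF.uniformOfFinset (G.neighborFinset v) h
  else PMF.pure v

/-- The transition kernel of simple random walk. -/
def stepKernel (G : SimpleGraph V) [G.LocallyFinite] : Kernel V V where
  toFun v := (G.stepLaw v).toMeasure
  measurable' := Measurable.of_discrete

instance (G : SimpleGraph V) [G.LocallyFinite] : IsMarkovKernel G.stepKernel :=
  ⟨fun v ↦ inferInstanceAs (IsProbabilityMeasure (G.stepLaw v).toMeasure)⟩

/-- The transition from the history up to time `n` to the position at time `n + 1`. -/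
def historyKernel (G : SimpleGraph V) [G.LocallyFinite] (n : ℕ) :
    Kernel ((i : Finset.Iic n) → V) V :=
  G.stepKernel.comap (fun h ↦ h ⟨n, Finset.mem_Iic.2 le_rfl⟩) (measurable_pi_apply _)

instance (G : SimpleGraph V) [G.LocallyFinite] (n : ℕ) : IsMarkovKernel (G.historyKernel n) :=
  inferInstanceAs (IsMarkovKernel (Kernel.comap _ _ _))

/-- The law of simple random walk `(X₀, X₁, …)` on `G` with `X₀ = u`. -/
def walkLaw (G : SimpleGraph V) [G.LocallyFinite] (u : V) : Measure (ℕ → V) :=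
  Kernel.traj (X := fun _ ↦ V) G.historyKernel 0 (fun _ ↦ u)

instance (G : SimpleGraph V) [G.LocallyFinite] (u : V) : IsProbabilityMeasure (G.walkLaw u) :=
  inferInstanceAs (IsProbabilityMeasure (Kernel.traj (X := fun _ ↦ V) G.historyKernel 0 _))

/-- The pairs of times at which the trajectories `x` and `y` are at the same vertex. -/
def intersectionTimes (x y : ℕ → V) : Set (ℕ × ℕ) := {p | x p.1 = y p.2}

/-- For a given trajectory `y`, the expected number of pairs of times `(i, j)` with `X i = y j`,
where `X` is simple random walk on `G` started at `u`. -/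
def expectedIntersections (G : SimpleGraph V) [G.LocallyFinite] (u : V) (y : ℕ → V) : ℝ≥0∞ :=
  ∫⁻ x, ((intersectionTimes x y).encard : ℝ≥0∞) ∂G.walkLaw u

/-- The infinite intersection property: two independent simple random walks on `G`, started
anywhere, almost surely intersect infinitely often. -/
def HasInfiniteIntersectionProperty (G : SimpleGraph V) [G.LocallyFinite] : Prop :=
  ∀ u v : V, ∀ᵐ p ∂(G.walkLaw u).prod (G.walkLaw v), (intersectionTimes p.1 p.2).Infinite

/-! These notions are invariant under graph isomorphism. -/

variable {G : SimpleGraph V} {H : SimpleGraph W} [G.LocallyFinite] [H.LocallyFinite]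

theorem stepKernel_iso (φ : G ≃g H) (v : V) :
    H.stepKernel (φ v) = (G.stepKernel v).map φ := by
  have key : H.stepLaw (φ v) = (G.stepLaw v).map φ := by
    classical
    have hN : H.neighborFinset (φ v) = (G.neighborFinset v).map φ.toEquiv.toEmbedding := by
      ext w
      obtain ⟨w, rfl⟩ := φ.surjective w
      rw [H.mem_neighborFinset, φ.map_adj_iff]
      simp only [Finset.mem_map, G.mem_neighborFinset]
      exact ⟨fun hw ↦ ⟨w, hw, rfl⟩, fun ⟨w', hw', e⟩ ↦ φ.injective e ▸ hw'⟩
    by_cases hv : (G.neighborFinset v).Nonempty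
    · have hv' : (H.neighborFinset (φ v)).Nonempty := by rw [hN]; simpa using hv
      rw [stepLaw, stepLaw, dif_pos hv, dif_pos hv']
      ext w
      obtain ⟨w, rfl⟩ := φ.surjective w
      rw [PMF.map_apply, tsum_eq_single w fun w' hw' ↦ if_neg fun h ↦ hw' (φ.injective h).symm]
      have hw : φ w ∈ H.neighborFinset (φ v) ↔ w ∈ G.neighborFinset v := by
        rw [H.mem_neighborFinset, φ.map_adj_iff, G.mem_neighborFinset]
      rw [if_pos rfl, PMF.uniformOfFinset_apply, PMF.uniformOfFinset_apply, if_congr hw rfl rfl,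
        hN, Finset.card_map]
    · have hv' : ¬ (H.neighborFinset (φ v)).Nonempty := by rw [hN]; simpa using hv
      rw [stepLaw, stepLaw, dif_neg hv, dif_neg hv', PMF.pure_map]
  change (H.stepLaw (φ v)).toMeasure = (G.stepLaw v).toMeasure.map φ
  rw [key, PMF.toMeasure_map _ _ Measurable.of_discrete]

theorem partialTraj_succ_self_apply (G : SimpleGraph V) [G.LocallyFinite] (n : ℕ)
    (x : (i : Finset.Iic n) → V) :
    Kernel.partialTraj (X := fun _ ↦ V) G.historyKernel n (n + 1) x =
      (G.stepKernel (x ⟨n, Finset.mem_Iic.2 le_rfl⟩)).map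
        (fun v ↦ IicProdIoc (X := fun _ ↦ V) n (n + 1)
          (x, MeasurableEquiv.piSingleton (X := fun _ ↦ V) n v)) := by
  have h1 := (MeasurableEquiv.piSingleton (X := fun _ ↦ V) n).measurable
  have h2 := measurable_IicProdIoc (X := fun _ : ℕ ↦ V) (m := n) (n := n + 1)
  rw [Kernel.partialTraj_succ_self, Kernel.map_apply _ h2, Kernel.prod_apply,
    Kernel.id_apply, Kernel.map_apply _ h1, Measure.dirac_prod,
    Measure.map_map measurable_prodMk_left h1,
    Measure.map_map h2 (measurable_prodMk_left.comp h1)]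
  rfl

theorem partialTraj_iso (φ : G ≃g H) (x : (i : Finset.Iic 0) → V) (n : ℕ) :
    Kernel.partialTraj (X := fun _ ↦ W) H.historyKernel 0 n (fun i ↦ φ (x i)) =
      (Kernel.partialTraj (X := fun _ ↦ V) G.historyKernel 0 n x).map (fun y i ↦ φ (y i)) := by
  have hm (n : ℕ) : Measurable fun (y : (i : Finset.Iic n) → V) i ↦ φ (y i) :=
    measurable_pi_lambda _ fun i ↦
      (Measurable.of_discrete (f := φ)).comp (measurable_pi_apply i)
  induction n with
  | zero =>
    rw [Kernel.partialTraj_self, Kernel.partialTraj_self, Kernel.id_apply, Kernel.id_apply,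
      Measure.map_dirac' (hm 0)]
  | succ n ih =>
    have step (y : (i : Finset.Iic n) → V) :
        Kernel.partialTraj (X := fun _ ↦ W) H.historyKernel n (n + 1) (fun i ↦ φ (y i)) =
          (Kernel.partialTraj (X := fun _ ↦ V) G.historyKernel n (n + 1) y).map
            (fun y i ↦ φ (y i)) := by
      rw [partialTraj_succ_self_apply, partialTraj_succ_self_apply, stepKernel_iso,
        Measure.map_map Measurable.of_discrete Measurable.of_discrete,
        Measure.map_map (hm _) Measurable.of_discrete]
      congr 1
      ext v i
      simp only [Function.comp, IicProdIoc]
      split_ifs with hi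
      · rfl
      · obtain ⟨i, hi'⟩ := i
        obtain rfl : i = n + 1 := by simp at hi hi'; lia
        rfl
    rw [Kernel.partialTraj_succ_eq_comp (Nat.zero_le n),
      Kernel.partialTraj_succ_eq_comp (Nat.zero_le n)]
    ext s hs
    rw [Kernel.comp_apply' _ _ _ hs, Measure.map_apply (hm _) hs,
      Kernel.comp_apply' _ _ _ (hm _ hs), ih, lintegral_map (Kernel.measurable_coe _ hs) (hm n)]
    simp only [step, Measure.map_apply (hm _) hs]

theorem walkLaw_iso (φ : G ≃g H) (u : V) :
    H.walkLaw (φ u) = (G.walkLaw u).map (fun x i ↦ φ (x i)) := by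
  have hm : Measurable fun (y : ℕ → V) i ↦ φ (y i) :=
    measurable_pi_lambda _ fun i ↦
      (Measurable.of_discrete (f := φ)).comp (measurable_pi_apply i)
  have hm' (n : ℕ) : Measurable fun (y : (i : Finset.Iic n) → V) i ↦ φ (y i) :=
    measurable_pi_lambda _ fun i ↦
      (Measurable.of_discrete (f := φ)).comp (measurable_pi_apply i)
  have hf := Preorder.measurable_frestrictLe (X := fun _ : ℕ ↦ W)
  have hf' := Preorder.measurable_frestrictLe (X := fun _ : ℕ ↦ V)
  have (I : Finset ℕ) : IsFiniteMeasure (inducedFamily (X := fun _ ↦ W) (fun n ↦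
      Kernel.partialTraj (X := fun _ ↦ W) H.historyKernel 0 n fun _ ↦ φ u) I) := by
    rw [inducedFamily]; infer_instance
  refine (Kernel.isProjectiveLimit_trajFun (X := fun _ ↦ W) H.historyKernel 0
    (fun _ ↦ φ u)).unique ?_
  rw [isProjectiveLimit_nat_iff (Kernel.isProjectiveMeasureFamily_partialTraj _ _)]
  intro n
  rw [inducedFamily_Iic]
  rw [partialTraj_iso φ (fun _ ↦ u) n, ← Kernel.traj_map_frestrictLe_apply,
    Measure.map_map (hf n) hm, Measure.map_map (hm' n) (hf' n)]
  rfl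

/-- The bijection between trajectories induced by a graph isomorphism. -/
def isoTrajectory (φ : G ≃g H) : (ℕ → V) ≃ᵐ (ℕ → W) where
  toEquiv := Equiv.piCongrRight fun _ ↦ φ.toEquiv
  measurable_toFun := measurable_pi_lambda _ fun i ↦
    (Measurable.of_discrete (f := φ)).comp (measurable_pi_apply i)
  measurable_invFun := measurable_pi_lambda _ fun i ↦
    (Measurable.of_discrete (f := φ.symm)).comp (measurable_pi_apply i)

theorem walkLaw_iso' (φ : G ≃g H) (u : V) :
    H.walkLaw (φ u) = (G.walkLaw u).map (isoTrajectory φ) := walkLaw_iso φ u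

theorem intersectionTimes_iso {G : SimpleGraph V} {H : SimpleGraph W} (φ : G ≃g H) (x y : ℕ → V) :
    intersectionTimes (isoTrajectory φ x) (isoTrajectory φ y) = intersectionTimes x y := by
  ext p
  exact φ.injective.eq_iff

theorem expectedIntersections_iso (φ : G ≃g H) (u : V) (y : ℕ → V) :
    H.expectedIntersections (φ u) (isoTrajectory φ y) = G.expectedIntersections u y := by
  simp only [expectedIntersections, walkLaw_iso', lintegral_map_equiv, intersectionTimes_iso]

theorem HasInfiniteIntersectionProperty.of_iso (φ : G ≃g H)
    (h : G.HasInfiniteIntersectionProperty) : H.HasInfiniteIntersectionProperty := by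
  intro u v
  obtain ⟨u, rfl⟩ := φ.surjective u
  obtain ⟨v, rfl⟩ := φ.surjective v
  have e : ((isoTrajectory φ).prodCongr (isoTrajectory φ) : _ → _) =
      Prod.map (isoTrajectory φ) (isoTrajectory φ) := rfl
  rw [walkLaw_iso', walkLaw_iso', Measure.map_prod_map _ _ (isoTrajectory φ).measurable
    (isoTrajectory φ).measurable, ← e, (MeasurableEquiv.measurableEmbedding _).ae_map_iff]
  filter_upwards [h u v] with p hp
  rw [e]
  simpa only [Prod.map_fst, Prod.map_snd, intersectionTimes_iso] using hp

end Walk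

end SimpleGraph

/-! ### Rooted graphs and the local topology -/

/-- A connected, locally finite graph with `k` distinguished vertices. Such a graph is countable, so
that vertex sets in `Type` account for all of them up to isomorphism. -/
structure RootedGraph (k : ℕ) where
  V : Type
  graph : SimpleGraph V
  connected : graph.Connected
  finite_neighborSet : ∀ v, (graph.neighborSet v).Finite
  root : Fin k → V

namespace RootedGraph

variable {k : ℕ}

instance (g : RootedGraph k) : g.graph.LocallyFinite := fun v ↦ (g.finite_neighborSet v).fintype

instance (g : RootedGraph k) : MeasurableSpace g.V := ⊤

instance (g : RootedGraph k) : DiscreteMeasurableSpace g.V := ⟨fun _ ↦ trivial⟩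

/-- Isomorphism of graphs preserving the distinguished vertices. -/
def IsIso (g h : RootedGraph k) : Prop :=
  ∃ φ : g.graph ≃g h.graph, ∀ i, φ (g.root i) = h.root i

instance setoid (k : ℕ) : Setoid (RootedGraph k) where
  r := IsIso
  iseqv :=
    { refl := fun _ ↦ ⟨.refl, fun _ ↦ rfl⟩
      symm := fun ⟨φ, hφ⟩ ↦ ⟨φ.symm, fun i ↦ by rw [← hφ i]; exact φ.symm_apply_apply _⟩
      trans := fun ⟨φ, hφ⟩ ⟨ψ, hψ⟩ ↦ ⟨φ.trans ψ, fun i ↦ by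
        rw [← hψ i, ← hφ i]; rfl⟩ }

/-- The vertices at graph distance at most `r` from some root. -/
def ball (g : RootedGraph k) (r : ℕ) : Set g.V := {v | ∃ i, g.graph.dist (g.root i) v ≤ r}

theorem root_mem_ball (g : RootedGraph k) (r : ℕ) (i : Fin k) : g.root i ∈ g.ball r :=
  ⟨i, by simp⟩

/-- The balls of radius `r` around the roots, with the graph structure induced on them, are
isomorphic by an isomorphism preserving the roots. -/
def BallIso (r : ℕ) (g h : RootedGraph k) : Prop :=
  ∃ φ : g.graph.induce (g.ball r) ≃g h.graph.induce (h.ball r),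
    ∀ i, φ ⟨g.root i, g.root_mem_ball r i⟩ = ⟨h.root i, h.root_mem_ball r i⟩

/-- The same graph with distinguished vertices `ρ`. -/
def reroot (g : RootedGraph k) {m : ℕ} (ρ : Fin m → g.V) : RootedGraph m :=
  { g with root := ρ }

end RootedGraph

/-- The space of isomorphism classes of connected, locally finite graphs with `k` roots. -/
def RootedGraphClass (k : ℕ) : Type 1 := Quotient (RootedGraph.setoid k)

namespace RootedGraphClass

open RootedGraph

/-- The isomorphism class of a rooted graph. -/
def mk {k : ℕ} (g : RootedGraph k) : RootedGraphClass k := Quotient.mk _ g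

/-- The local topology: the classes of the graphs whose `r`-ball around the roots is isomorphic to
that of `g`, for `r : ℕ`, are the basic neighbourhoods of the class of `g`. -/
instance (k : ℕ) : TopologicalSpace (RootedGraphClass k) :=
  TopologicalSpace.generateFrom {U | ∃ g r, U = mk '' {h | BallIso r g h}}

instance (k : ℕ) : MeasurableSpace (RootedGraphClass k) := borel _

instance (k : ℕ) : BorelSpace (RootedGraphClass k) := ⟨rfl⟩

/-- The degree of the root. -/
def rootDegree (c : RootedGraphClass 1) : ℕ :=
  Quotient.lift (fun g : RootedGraph 1 ↦ g.graph.degree (g.root 0))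
    (by
      rintro g h ⟨φ, hφ⟩
      rw [← hφ 0]
      exact (φ.degree_eq _).symm) c

theorem mk_reroot_iso {g h : RootedGraph 1} (φ : g.graph ≃g h.graph) {m : ℕ} (ρ : Fin m → g.V) :
    mk (h.reroot (φ ∘ ρ)) = mk (g.reroot ρ) :=
  (Quotient.sound ⟨φ, fun _ ↦ rfl⟩ : mk (g.reroot ρ) = mk (h.reroot (φ ∘ ρ))).symm

/-- The total mass `∑ v, F (G, o, v)` sent by the root. -/
def massSent (F : RootedGraphClass 2 → ℝ≥0) (c : RootedGraphClass 1) : ℝ≥0∞ :=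
  Quotient.lift (fun g : RootedGraph 1 ↦ ∑' v : g.V, (F (mk (g.reroot ![g.root 0, v])) : ℝ≥0∞))
    (by
      rintro g h ⟨φ, hφ⟩
      simp only [← hφ 0]
      rw [← φ.toEquiv.tsum_eq]
      refine tsum_congr fun v ↦ ?_
      rw [← mk_reroot_iso φ]
      exact congrArg (fun ρ ↦ (F (mk (h.reroot ρ)) : ℝ≥0∞)) (by ext i; fin_cases i <;> rfl)) c

/-- The total mass `∑ v, F (G, v, o)` received by the root. -/
def massReceived (F : RootedGraphClass 2 → ℝ≥0) (c : RootedGraphClass 1) : ℝ≥0∞ :=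
  Quotient.lift (fun g : RootedGraph 1 ↦ ∑' v : g.V, (F (mk (g.reroot ![v, g.root 0])) : ℝ≥0∞))
    (by
      rintro g h ⟨φ, hφ⟩
      simp only [← hφ 0]
      rw [← φ.toEquiv.tsum_eq]
      refine tsum_congr fun v ↦ ?_
      rw [← mk_reroot_iso φ]
      exact congrArg (fun ρ ↦ (F (mk (h.reroot ρ)) : ℝ≥0∞)) (by ext i; fin_cases i <;> rfl)) c

/-- For two simple random walks `X`, `Y` on `(G, o)` started at `o` and independent given `(G, o)`,
the conditional expectation of the number of pairs of times `(i, j)` with `X i = Y j`, given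
`(G, o)` and `Y`, is infinite for almost every `Y`. -/
def HasInfiniteExpectedIntersections (c : RootedGraphClass 1) : Prop :=
  Quotient.lift (fun g : RootedGraph 1 ↦ ∀ᵐ y ∂g.graph.walkLaw (g.root 0),
      g.graph.expectedIntersections (g.root 0) y = ∞)
    (by
      rintro g h ⟨φ, hφ⟩
      rw [← hφ 0, SimpleGraph.walkLaw_iso',
        (MeasurableEquiv.measurableEmbedding _).ae_map_iff]
      simp only [SimpleGraph.expectedIntersections_iso]) c

/-- The underlying graph has the infinite intersection property. -/
def HasInfiniteIntersectionProperty (c : RootedGraphClass 1) : Prop :=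
  Quotient.lift (fun g : RootedGraph 1 ↦ g.graph.HasInfiniteIntersectionProperty)
    (by
      rintro g h ⟨φ, -⟩
      exact propext ⟨.of_iso φ, .of_iso φ.symm⟩) c

end RootedGraphClass

/-- A random rooted graph `(G, o)` is unimodular if it satisfies the mass-transport principle. -/
def IsUnimodular {Ω : Type*} [MeasurableSpace Ω] (P : Measure Ω) (G : Ω → RootedGraphClass 1) :
    Prop :=
  ∀ F : RootedGraphClass 2 → ℝ≥0, Measurable F →
    ∫⁻ ω, (G ω).massSent F ∂P = ∫⁻ ω, (G ω).massReceived F ∂P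

end

set_option linter.unusedSectionVars false

/-! Call `v` bad if two independent walks from `v` have, with positive probability, their last
meeting at time `(0, 0)`: the second walk never again meets the trace of the first, and the first
never returns to `v`. The proof shows that almost surely no vertex is bad, and that a connected
graph without bad vertices has the infinite intersection property.

For the root, let `u` send to `v` the mass `max (deg u) 1 ^ 2` times the probability that the last
meeting of two walks from `u` is at `v` (`lastMeetingTransport`). Last meetings are unique, so at
most `deg(o)^2 + 1` is sent, which has finite expectation. Reversing both walks on their way from
`u` to `v` turns the degrees of `u` into those of `v`. The mass received by `v` becomes the expected
number of meetings of two walks from `v`, where one of them must avoid the later trace of a third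
walk up to the meeting, weighted by an escape probability. Requiring avoidance for all time only
decreases this number, and on that event the hypothesis makes it infinite. So a bad root receives
infinite mass (`tsum_sq_mul_prod_walkLaw_lastMeetingAt_eq_top`), and mass transport excludes this
almost surely.

For the other vertices, a second transport (`meetingTransport`) sends mass from `u` to `v` only if
`v` is bad and can be reached from `u` in `n` steps. Almost surely nothing is received, hence
nothing is sent.

Without bad vertices, two walks meet infinitely often or never (`ae_infinite_or_eq_empty`). Walks
with the same start do meet, and this spreads to other starting points along edges
(`prod_walkLaw_eq_empty_of_adj`). -/

namespace SimpleGraph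

/-! ### Cylinder probabilities and the Markov property. -/

section WalkLaw

open Preorder

theorem Connected.countable_of_locallyFinite {V : Type*} {G : SimpleGraph V}
    (hG : G.Connected) (hf : ∀ v, (G.neighborSet v).Finite) : Countable V := by
  obtain ⟨o⟩ := hG.nonempty
  have h (n : ℕ) : {v | ∃ w : G.Walk v o, w.length = n}.Countable := by
    induction n with
    | zero =>
      refine (Set.countable_singleton o).mono ?_
      rintro v ⟨w, hw⟩
      exact Walk.eq_of_length_eq_zero hw
    | succ n ih =>
      refine (ih.biUnion fun v _ ↦ (hf v).countable).mono ?_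
      rintro v ⟨w, hw⟩
      cases w with
      | nil => simp at hw
      | cons hadj w =>
        simp only [Walk.length_cons, add_left_inj] at hw
        simp only [Set.mem_iUnion]
        exact ⟨_, ⟨w, hw⟩, hadj.symm⟩
  have hu : (Set.univ : Set V) = ⋃ n, {v | ∃ w : G.Walk v o, w.length = n} := by
    refine (Set.eq_univ_of_forall fun v ↦ ?_).symm
    obtain ⟨w⟩ := hG.preconnected v o
    exact Set.mem_iUnion.2 ⟨w.length, w, rfl⟩
  exact Set.countable_univ_iff.1 (hu ▸ Set.countable_iUnion h)

variable {V : Type*} [MeasurableSpace V] [DiscreteMeasurableSpace V]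

/-- The trajectories that agree with `a` up to time `n`. -/
def pathCylinder (a : ℕ → V) (n : ℕ) : Set (ℕ → V) := {x | ∀ i ≤ n, x i = a i}

theorem pathCylinder_eq_preimage (a : ℕ → V) (n : ℕ) :
    pathCylinder a n = frestrictLe (π := fun _ ↦ V) n ⁻¹' {frestrictLe n a} := by
  ext x
  simp [pathCylinder, funext_iff, frestrictLe, Finset.restrict]

/-- The trajectory after time `n`. -/
def shiftBy (n : ℕ) (x : ℕ → V) : ℕ → V := fun k ↦ x (n + k)

@[fun_prop]
theorem measurable_shiftBy (n : ℕ) : Measurable (shiftBy (V := V) n) :=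
  measurable_pi_lambda _ fun _ ↦ measurable_pi_apply _

variable [Countable V]

theorem measurableSet_pathCylinder (a : ℕ → V) (n : ℕ) : MeasurableSet (pathCylinder a n) := by
  rw [pathCylinder_eq_preimage]
  exact measurable_frestrictLe n (measurableSet_singleton _)

theorem measure_ext_of_map_frestrictLe {μ ν : Measure (ℕ → V)} [IsFiniteMeasure μ]
    (h : ∀ n, μ.map (frestrictLe n) = ν.map (frestrictLe n)) : μ = ν := by
  have h1 : IsProjectiveLimit μ fun I : Finset ℕ ↦ μ.map I.restrict := fun I ↦ rfl
  have h2 : IsProjectiveLimit ν fun I : Finset ℕ ↦ μ.map I.restrict := by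
    intro I
    have hI := I.subset_Iic_sup_id
    have key (ρ : Measure (ℕ → V)) : ρ.map I.restrict =
        (ρ.map (frestrictLe (I.sup id))).map (Finset.restrict₂ (π := fun _ ↦ V) hI) := by
      rw [Measure.map_map (by fun_prop) (by fun_prop)]
      rfl
    rw [key ν, ← h, ← key μ]
  exact h1.unique h2

theorem measure_ext_of_pathCylinder {μ ν : Measure (ℕ → V)} [IsFiniteMeasure μ]
    (h : ∀ a n, μ (pathCylinder a n) = ν (pathCylinder a n)) : μ = ν := by
  rcases isEmpty_or_nonempty V with hV | ⟨⟨v₀⟩⟩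
  · exact Subsingleton.elim _ _
  refine measure_ext_of_map_frestrictLe fun n ↦ Measure.ext_of_singleton fun b ↦ ?_
  obtain ⟨a, rfl⟩ : ∃ a : ℕ → V, frestrictLe n a = b := by
    refine ⟨fun i ↦ if hi : i ≤ n then b ⟨i, Finset.mem_Iic.2 hi⟩ else v₀, ?_⟩
    ext ⟨i, hi⟩
    simp [frestrictLe, Finset.mem_Iic.1 hi]
  rw [Measure.map_apply (measurable_frestrictLe n) (measurableSet_singleton _),
    Measure.map_apply (measurable_frestrictLe n) (measurableSet_singleton _),
    ← pathCylinder_eq_preimage]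
  exact h a n

variable (G : SimpleGraph V) [G.LocallyFinite]

theorem stepKernel_singleton (v w : V) : G.stepKernel v {w} = G.stepLaw v w :=
  PMF.toMeasure_apply_singleton _ _ (measurableSet_singleton w)

theorem walkLaw_map_frestrictLe (u : V) (n : ℕ) :
    (G.walkLaw u).map (frestrictLe n) =
      Kernel.partialTraj (X := fun _ ↦ V) G.historyKernel 0 n (fun _ ↦ u) :=
  Kernel.traj_map_frestrictLe_apply _ _ _

theorem walkLaw_pathCylinder_zero (u : V) (a : ℕ → V) [Decidable (u = a 0)] :
    G.walkLaw u (pathCylinder a 0) = if u = a 0 then 1 else 0 := by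
  classical
  rw [pathCylinder_eq_preimage,
    ← Measure.map_apply (measurable_frestrictLe 0) (measurableSet_singleton _),
    walkLaw_map_frestrictLe, Kernel.partialTraj_self, Kernel.id_apply,
    Measure.dirac_apply' _ (measurableSet_singleton _), Set.indicator_apply]
  have : (fun _ ↦ u) ∈ ({frestrictLe 0 a} : Set ((i : Finset.Iic 0) → V)) ↔ u = a 0 := by
    simp [funext_iff, frestrictLe]
  simp only [this, Pi.one_apply]

theorem walkLaw_pathCylinder_succ (u : V) (a : ℕ → V) (n : ℕ) :
    G.walkLaw u (pathCylinder a (n + 1)) =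
      G.walkLaw u (pathCylinder a n) * G.stepLaw (a n) (a (n + 1)) := by
  rw [pathCylinder_eq_preimage, pathCylinder_eq_preimage,
    ← Measure.map_apply (measurable_frestrictLe _) (measurableSet_singleton _),
    ← Measure.map_apply (measurable_frestrictLe _) (measurableSet_singleton _),
    walkLaw_map_frestrictLe, walkLaw_map_frestrictLe,
    Kernel.partialTraj_succ_eq_comp (Nat.zero_le n),
    Kernel.comp_apply' _ _ _ (measurableSet_singleton _)]
  have key (y : (i : Finset.Iic n) → V) :
      Kernel.partialTraj (X := fun _ ↦ V) G.historyKernel n (n + 1) y {frestrictLe (n + 1) a} =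
        ({frestrictLe n a} : Set ((i : Finset.Iic n) → V)).indicator
          (fun _ ↦ G.stepLaw (a n) (a (n + 1))) y := by
    classical
    rw [partialTraj_succ_self_apply, Measure.map_apply Measurable.of_discrete
      (measurableSet_singleton _), Set.indicator_apply]
    split_ifs with hy
    · rw [Set.mem_singleton_iff] at hy
      subst hy
      rw [← stepKernel_singleton]
      congr 1
      ext v
      simp only [Set.mem_preimage, Set.mem_singleton_iff, funext_iff, IicProdIoc]
      constructor
      · intro h
        have := h ⟨n + 1, by simp⟩
        rw [dif_neg (by simp)] at this
        exact this
      · rintro rfl ⟨i, hi⟩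
        split_ifs with h
        · rfl
        · obtain rfl : i = n + 1 := by simp at hi h; lia
          rfl
    · convert measure_empty (μ := G.stepKernel _)
      ext v
      simp only [Set.mem_preimage, Set.mem_singleton_iff, Set.mem_empty_iff_false, iff_false]
      intro h
      refine hy ?_
      ext ⟨i, hi⟩
      have := congrFun h ⟨i, by simp at hi ⊢; lia⟩
      simpa [IicProdIoc, Finset.mem_Iic.1 hi] using this
  simp only [key]
  rw [lintegral_indicator_const (measurableSet_singleton _), mul_comm]

theorem walkLaw_pathCylinder_add (u : V) (a : ℕ → V) (n k : ℕ) :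
    G.walkLaw u (pathCylinder a (n + k)) =
      G.walkLaw u (pathCylinder a n) * G.walkLaw (a n) (pathCylinder (shiftBy n a) k) := by
  classical
  induction k with
  | zero => rw [walkLaw_pathCylinder_zero]; simp [shiftBy]
  | succ k ih =>
    rw [← add_assoc, walkLaw_pathCylinder_succ, ih, walkLaw_pathCylinder_succ, mul_assoc]
    rfl

/-- Both sides are finite measures in `A`, so it suffices to compare them on path cylinders, where
cylinder probabilities are multiplicative. -/
theorem walkLaw_pathCylinder_inter_shiftBy (u : V) (a : ℕ → V) (n : ℕ) {A : Set (ℕ → V)}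
    (hA : MeasurableSet A) :
    G.walkLaw u (pathCylinder a n ∩ shiftBy n ⁻¹' A) =
      G.walkLaw u (pathCylinder a n) * G.walkLaw (a n) A := by
  classical
  suffices h : ((G.walkLaw u).restrict (pathCylinder a n)).map (shiftBy n) =
      G.walkLaw u (pathCylinder a n) • G.walkLaw (a n) by
    have := congrArg (fun μ ↦ μ A) h
    simpa [Measure.map_apply (measurable_shiftBy n) hA,
      Measure.restrict_apply (measurable_shiftBy n hA), Set.inter_comm] using this
  refine measure_ext_of_pathCylinder fun b k ↦ ?_
  rw [Measure.map_apply (measurable_shiftBy n) (measurableSet_pathCylinder b k),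
    Measure.restrict_apply (measurable_shiftBy n (measurableSet_pathCylinder b k)),
    Measure.smul_apply, smul_eq_mul]
  by_cases hb : a n = b 0
  · let c : ℕ → V := fun i ↦ if i < n then a i else b (i - n)
    have hc : shiftBy n c = b := by ext i; simp [shiftBy, c]
    have hcn : c n = a n := by simp [c, hb]
    have h1 : pathCylinder c n = pathCylinder a n := by
      ext x
      refine forall₂_congr fun i hi ↦ ?_
      rcases hi.lt_or_eq with h | rfl
      · simp [c, h]
      · rw [hcn]
    have h2 : shiftBy n ⁻¹' pathCylinder b k ∩ pathCylinder a n = pathCylinder c (n + k) := by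
      rw [← h1, ← hc]
      ext x
      constructor
      · rintro ⟨hx, hx'⟩ i hi
        rcases le_or_gt i n with h | h
        · exact hx' i h
        · obtain ⟨j, rfl⟩ := Nat.exists_eq_add_of_le h.le
          exact hx j (by lia)
      · exact fun hx ↦ ⟨fun i hi ↦ hx (n + i) (by lia), fun i hi ↦ hx i (by lia)⟩
    rw [h2, walkLaw_pathCylinder_add, h1, hc, hcn]
  · have h0 : G.walkLaw (a n) (pathCylinder b k) = 0 := by
      refine measure_mono_null (t := pathCylinder b 0) (fun x hx i hi ↦ hx i (by lia)) ?_
      rw [walkLaw_pathCylinder_zero, if_neg hb]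
    rw [h0, mul_zero]
    convert measure_empty (μ := G.walkLaw u)
    ext x
    simp only [Set.mem_inter_iff, Set.mem_preimage, Set.mem_empty_iff_false, iff_false, not_and]
    intro hx hx'
    exact hb ((hx' n le_rfl).symm.trans (hx 0 (Nat.zero_le k)))

/-- The set `B` of trajectories is determined by the positions up to time `n`. -/
def DeterminedBy (B : Set (ℕ → V)) (n : ℕ) : Prop :=
  ∀ ⦃x y : ℕ → V⦄, (∀ i ≤ n, x i = y i) → x ∈ B → y ∈ B

variable {G}

theorem DeterminedBy.eq_preimage {B : Set (ℕ → V)} {n : ℕ} (hB : DeterminedBy B n) :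
    B = frestrictLe (π := fun _ ↦ V) n ⁻¹' (frestrictLe n '' B) := by
  refine (Set.subset_preimage_image _ _).antisymm ?_
  rintro x ⟨y, hy, hxy⟩
  exact hB (fun i hi ↦ congrFun hxy ⟨i, Finset.mem_Iic.2 hi⟩) hy

theorem DeterminedBy.measurableSet {B : Set (ℕ → V)} {n : ℕ} (hB : DeterminedBy B n) :
    MeasurableSet B := by
  rw [hB.eq_preimage]
  exact measurable_frestrictLe n .of_discrete

/-- The Markov property at a fixed time. -/
theorem walkLaw_inter_shiftBy (G : SimpleGraph V) [G.LocallyFinite] (u v : V) {n : ℕ}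
    {B : Set (ℕ → V)} (hB : DeterminedBy B n) (hv : ∀ x ∈ B, x n = v) {A : Set (ℕ → V)}
    (hA : MeasurableSet A) :
    G.walkLaw u (B ∩ shiftBy n ⁻¹' A) = G.walkLaw u B * G.walkLaw v A := by
  have hm (b : (i : Finset.Iic n) → V) :
      MeasurableSet (frestrictLe (π := fun _ ↦ V) n ⁻¹' {b}) :=
    measurable_frestrictLe n (measurableSet_singleton _)
  -- `B` is a countable disjoint union of path cylinders of length `n`, so the Markov property can
  -- be summed over them.
  have hc := (frestrictLe (π := fun _ ↦ V) n '' B).to_countable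
  have key (μ : Measure (ℕ → V)) : μ B =
      ∑' b : frestrictLe (π := fun _ ↦ V) n '' B, μ (frestrictLe n ⁻¹' {b.1}) := by
    rw [tsum_measure_preimage_singleton hc fun b _ ↦ hm b, ← hB.eq_preimage]
  rw [← Measure.restrict_apply hB.measurableSet, key, key (G.walkLaw u), ← ENNReal.tsum_mul_right]
  refine tsum_congr ?_
  rintro ⟨_, a, ha, rfl⟩
  rw [Measure.restrict_apply (hm _), ← pathCylinder_eq_preimage,
    walkLaw_pathCylinder_inter_shiftBy _ _ _ _ hA, hv a ha]

theorem walkLaw_eval_inter_shiftBy (G : SimpleGraph V) [G.LocallyFinite] (u v : V) (n : ℕ)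
    {A : Set (ℕ → V)} (hA : MeasurableSet A) :
    G.walkLaw u ({x | x n = v} ∩ shiftBy n ⁻¹' A) = G.walkLaw u {x | x n = v} * G.walkLaw v A :=
  walkLaw_inter_shiftBy G u v (fun _ _ h hx ↦ (h n le_rfl).symm.trans hx) (fun _ h ↦ h) hA

theorem walkLaw_start (G : SimpleGraph V) [G.LocallyFinite] (u : V) :
    ∀ᵐ x ∂G.walkLaw u, x 0 = u := by
  classical
  have h : G.walkLaw u {x | x 0 = u} = 1 := by
    have := G.walkLaw_pathCylinder_zero u fun _ ↦ u
    simpa [pathCylinder] using this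
  exact (prob_compl_eq_zero_iff
    (measurable_pi_apply (X := fun _ ↦ V) 0 (measurableSet_singleton u))).2 h

theorem walkLaw_one (G : SimpleGraph V) [G.LocallyFinite] (u v : V) :
    G.walkLaw u {x | x 1 = v} = G.stepLaw u v := by
  classical
  have h1 := G.walkLaw_pathCylinder_succ u (fun i ↦ if i = 0 then u else v) 0
  rw [walkLaw_pathCylinder_zero] at h1
  simp only [if_true, one_mul, zero_add, one_ne_zero, if_false] at h1
  rw [← h1]
  refine measure_congr ?_
  filter_upwards [walkLaw_start G u] with x hx
  refine propext ⟨fun (h : x 1 = v) i hi ↦ ?_, fun h ↦ ?_⟩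
  swap
  · exact (h 1 le_rfl).trans (by simp)
  interval_cases i
  · simpa using hx
  · simpa using h

end WalkLaw

end SimpleGraph

namespace SimpleGraph

/-! ### Last meetings, and reversibility of the walk killed on a set. -/

section Meeting

variable {V : Type*} [MeasurableSpace V] [DiscreteMeasurableSpace V]

/-- The pairs of trajectories whose last meeting happens at `v`, at time `i` for the first and at
time `j` for the second trajectory: the second does not meet the trace of the first after time `j`,
and the first does not return to `v` after time `i`. -/
def lastMeetingAt (i j : ℕ) (v : V) : Set ((ℕ → V) × (ℕ → V)) :=
  {p | p.1 i = v ∧ p.2 j = v ∧ (∀ k > j, ∀ l, p.2 k ≠ p.1 l) ∧ ∀ l > i, p.1 l ≠ v}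

/-- The trajectories that are at `v` at time `n` and avoid `S` up to that time. -/
def avoidUpTo (S : Set V) (n : ℕ) (v : V) : Set (ℕ → V) := {x | (∀ i ≤ n, x i ∉ S) ∧ x n = v}

/-- The trajectories that avoid `S` and do not return to `v`. -/
def escape (S : Set V) (v : V) : Set (ℕ → V) := {x | (∀ i, x i ∉ S) ∧ ∀ i > 0, x i ≠ v}

/-- The vertices visited after time `0`. -/
def laterTrace (y : ℕ → V) : Set V := {v | ∃ k > 0, y k = v}

/-- The last meeting is unique: `j` is the last time at which the second walk is on the trace of the
first, this determines `v`, and `i` is the last visit of the first walk to `v`. Hence the mass sent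
by a vertex is bounded. -/
theorem pairwise_disjoint_lastMeetingAt :
    Pairwise fun p q : (ℕ × ℕ) × V ↦
      Disjoint (lastMeetingAt p.1.1 p.1.2 p.2) (lastMeetingAt q.1.1 q.1.2 q.2) := by
  rintro ⟨⟨i, j⟩, v⟩ ⟨⟨i', j'⟩, v'⟩ hne
  rw [Set.disjoint_left]
  rintro ⟨x, y⟩ ⟨h1, h2, h3, h4⟩ ⟨h1', h2', h3', h4'⟩
  dsimp only at *
  have hj : j = j' := by
    rcases lt_trichotomy j j' with h | h | h
    · exact (h3 j' h i' (h2'.trans h1'.symm)).elim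
    · exact h
    · exact (h3' j h i (h2.trans h1.symm)).elim
  subst hj
  obtain rfl : v = v' := h2.symm.trans h2'
  have hi : i = i' := by
    rcases lt_trichotomy i i' with h | h | h
    · exact (h4 i' h h1').elim
    · exact h
    · exact (h4' i h h1).elim
  exact hne (by rw [hi])

theorem determinedBy_avoidUpTo (S : Set V) (n : ℕ) (v : V) :
    DeterminedBy (avoidUpTo S n v) n :=
  fun _ _ h hx ↦ ⟨fun i hi ↦ h i hi ▸ hx.1 i hi, h n le_rfl ▸ hx.2⟩

variable [Countable V]

theorem measurableSet_avoidUpTo (S : Set V) (n : ℕ) (v : V) :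
    MeasurableSet (avoidUpTo S n v) := (determinedBy_avoidUpTo S n v).measurableSet

theorem measurable_pos_eq (i j : ℕ) :
    Measurable fun p : (ℕ → V) × (ℕ → V) ↦ p.1 i = p.2 j :=
  (Measurable.of_discrete (f := fun q : V × V ↦ q.1 = q.2)).comp
    (g := fun q : V × V ↦ q.1 = q.2) (f := fun p : (ℕ → V) × (ℕ → V) ↦ (p.1 i, p.2 j))
    (by fun_prop)

theorem measurable_eval_eq (i : ℕ) (v : V) : Measurable fun x : ℕ → V ↦ x i = v :=
  (Measurable.of_discrete (f := fun w ↦ w = v)).comp (measurable_pi_apply i)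

theorem measurableSet_eval_eq (i : ℕ) (v : V) : MeasurableSet {x : ℕ → V | x i = v} :=
  measurableSet_setOfPred.2 (measurable_eval_eq i v)

theorem measurableSet_lastMeetingAt (i j : ℕ) (v : V) :
    MeasurableSet (lastMeetingAt i j v) := by
  have h1 (i : ℕ) : Measurable fun p : (ℕ → V) × (ℕ → V) ↦ p.1 i = v :=
    (measurable_eval_eq i v).comp measurable_fst
  have h2 (i : ℕ) : Measurable fun p : (ℕ → V) × (ℕ → V) ↦ p.2 i = v :=
    (measurable_eval_eq i v).comp measurable_snd
  refine measurableSet_setOfPred.2 ((h1 i).and ((h2 j).and (.and ?_ ?_)))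
  · refine .forall fun k ↦ .forall fun _ ↦ .forall fun l ↦ ?_
    simpa only [eq_comm, ne_eq] using (measurable_pos_eq l k).not
  · exact .forall fun l ↦ .forall fun _ ↦ (h1 l).not

theorem measurableSet_escape (S : Set V) (v : V) : MeasurableSet (escape S v) := by
  refine measurableSet_setOfPred.2 (.and ?_ ?_)
  · exact .forall fun i ↦ (Measurable.of_discrete (f := fun w ↦ w ∉ S)).comp
      (measurable_pi_apply i)
  · exact .forall fun l ↦ .forall fun _ ↦ (measurable_eval_eq l v).not

theorem measurable_notMem_laterTrace (i : ℕ) :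
    Measurable fun p : (ℕ → V) × (ℕ → V) ↦ p.1 i ∉ laterTrace p.2 := by
  refine Measurable.not (.exists fun k ↦ .and measurable_const ?_)
  simpa only [eq_comm, ne_eq] using measurable_pos_eq i k

theorem measurableSet_escape_laterTrace (v : V) :
    MeasurableSet {p : (ℕ → V) × (ℕ → V) | p.1 ∈ escape (laterTrace p.2) v} :=
  measurableSet_setOfPred.2 <| .and (.forall measurable_notMem_laterTrace) <|
    .forall fun l ↦ .forall fun _ ↦ ((measurable_eval_eq l v).comp measurable_fst).not

theorem measurableSet_avoidUpTo_laterTrace (n : ℕ) (v : V) :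
    MeasurableSet {p : (ℕ → V) × (ℕ → V) | p.1 ∈ avoidUpTo (laterTrace p.2) n v} :=
  measurableSet_setOfPred.2 <| .and
    (.forall fun i ↦ .forall fun _ ↦ measurable_notMem_laterTrace i)
    ((measurable_eval_eq n v).comp measurable_fst)

variable (G : SimpleGraph V) [G.LocallyFinite]

/-! ### Reversibility -/

/-- Weight times transition probability is the indicator of a symmetric relation. The maximum with
`1` keeps the weight positive at an isolated vertex, where the walk stays put. -/
theorem stepLaw_comm (u v : V) :
    ((max (G.degree u) 1 : ℕ) : ℝ≥0∞) * G.stepLaw u v =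
      ((max (G.degree v) 1 : ℕ) : ℝ≥0∞) * G.stepLaw v u := by
  classical
  have key (u v : V) : ((max (G.degree u) 1 : ℕ) : ℝ≥0∞) * G.stepLaw u v =
      if G.Adj u v ∨ (u = v ∧ G.degree u = 0) then 1 else 0 := by
    by_cases h : (G.neighborFinset u).Nonempty
    · have hd : 0 < G.degree u := Finset.card_pos.2 h
      rw [stepLaw, dif_pos h, PMF.uniformOfFinset_apply, max_eq_left hd]
      simp only [mem_neighborFinset, hd.ne', and_false, or_false, card_neighborFinset_eq_degree]
      split_ifs
      · exact ENNReal.mul_inv_cancel (by simpa using hd.ne') (by simp)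
      · simp
    · have hd : G.degree u = 0 := by
        rw [← card_neighborFinset_eq_degree, Finset.not_nonempty_iff_eq_empty.1 h,
          Finset.card_empty]
      have ha : ¬ G.Adj u v := fun ha ↦ h ⟨v, (G.mem_neighborFinset u v).2 ha⟩
      rw [stepLaw, dif_neg h, PMF.pure_apply]
      simp [hd, ha, eq_comm]
  rw [key, key]
  refine if_congr ?_ rfl rfl
  rw [G.adj_comm]
  refine or_congr Iff.rfl ?_
  constructor <;> (rintro ⟨rfl, h⟩; exact ⟨rfl, h⟩)

theorem measure_eq_tsum_inter_preimage {α : Type*} [MeasurableSpace α] (μ : Measure α)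
    {f : α → V} (hf : Measurable f) (A : Set α) : μ A = ∑' w, μ (A ∩ f ⁻¹' {w}) := by
  have h := tsum_measure_preimage_singleton (μ := μ.restrict A) (f := f) (Set.countable_univ)
    fun y _ ↦ hf (measurableSet_singleton y)
  rw [Set.preimage_univ, Measure.restrict_apply_univ,
    tsum_univ (f := fun y ↦ (μ.restrict A) (f ⁻¹' {y}))] at h
  rw [← h]
  refine tsum_congr fun w ↦ ?_
  rw [Measure.restrict_apply (hf (measurableSet_singleton w)), Set.inter_comm]

theorem walkLaw_avoidUpTo_succ (S : Set V) (n : ℕ) (u v : V) [Decidable (v ∈ S)] :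
    G.walkLaw u (avoidUpTo S (n + 1) v) =
      ∑' w, G.walkLaw u (avoidUpTo S n w) * (G.stepLaw w v * if v ∈ S then 0 else 1) := by
  rw [measure_eq_tsum_inter_preimage _ (measurable_pi_apply n)]
  refine tsum_congr fun w ↦ ?_
  have h : avoidUpTo S (n + 1) v ∩ (fun x ↦ x n) ⁻¹' {w} =
      avoidUpTo S n w ∩ shiftBy n ⁻¹' {x | x 1 = v ∧ v ∉ S} := by
    ext x
    simp only [avoidUpTo, Set.mem_inter_iff, Set.mem_ofPred_eq, Set.mem_preimage,
      Set.mem_singleton_iff, shiftBy]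
    constructor
    · rintro ⟨⟨h1, h2⟩, h3⟩
      exact ⟨⟨fun i hi ↦ h1 i (by lia), h3⟩, h2, h2 ▸ h1 _ le_rfl⟩
    · rintro ⟨⟨h1, h2⟩, h3, h4⟩
      refine ⟨⟨fun i hi ↦ ?_, h3⟩, h2⟩
      rcases Nat.le_succ_iff.1 hi with hi | rfl
      · exact h1 i hi
      · rw [Nat.succ_eq_add_one, h3]
        exact h4
  have hm : MeasurableSet {x : ℕ → V | x 1 = v ∧ v ∉ S} :=
    (measurableSet_eval_eq 1 v).inter (.const _)
  rw [h, walkLaw_inter_shiftBy G u w (determinedBy_avoidUpTo S n w) (fun x hx ↦ hx.2) hm]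
  by_cases hv : v ∈ S
  · simp [hv]
  · simp [hv, walkLaw_one]

theorem walkLaw_avoidUpTo_succ' (S : Set V) (n : ℕ) (u v : V) [Decidable (u ∈ S)] :
    G.walkLaw u (avoidUpTo S (n + 1) v) =
      ∑' w, (if u ∈ S then 0 else 1) * G.stepLaw u w * G.walkLaw w (avoidUpTo S n v) := by
  rw [measure_eq_tsum_inter_preimage _ (measurable_pi_apply 1)]
  refine tsum_congr fun w ↦ ?_
  by_cases hu : u ∈ S
  · simp only [hu, if_true, zero_mul]
    refine measure_mono_null (t := {x | ¬ x 0 = u}) ?_ (walkLaw_start G u)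
    rintro x ⟨hx, -⟩ h0
    exact hx.1 0 (Nat.zero_le _) (h0 ▸ hu)
  · simp only [hu, if_false, one_mul]
    rw [← walkLaw_one, ← walkLaw_eval_inter_shiftBy G u w 1 (measurableSet_avoidUpTo S n v)]
    refine measure_congr ?_
    filter_upwards [walkLaw_start G u] with x hx
    refine propext ⟨fun h ↦ ⟨h.2, fun i hi ↦ h.1.1 _ (by lia), ?_⟩,
      fun h ↦ ⟨⟨fun i hi ↦ ?_, ?_⟩, h.1⟩⟩
    · simpa [shiftBy, add_comm] using h.1.2
    · rcases i with - | i
      · rwa [hx]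
      · simpa [shiftBy, add_comm] using h.2.1 i (by lia)
    · simpa [shiftBy, add_comm] using h.2.2

/-- Avoidance is required at both endpoints, so the condition is invariant under time reversal. The
induction peels the last step off one side and the first step off the other. -/
theorem walkLaw_avoidUpTo_comm (S : Set V) (n : ℕ) (u v : V) :
    ((max (G.degree u) 1 : ℕ) : ℝ≥0∞) * G.walkLaw u (avoidUpTo S n v) =
      ((max (G.degree v) 1 : ℕ) : ℝ≥0∞) * G.walkLaw v (avoidUpTo S n u) := by
  classical
  induction n generalizing u v with
  | zero =>
    by_cases h : u = v
    · rw [h]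
    have h0 {u v : V} (h : u ≠ v) : G.walkLaw u (avoidUpTo S 0 v) = 0 := by
      refine measure_mono_null (t := {x | ¬ x 0 = u}) ?_ (walkLaw_start G u)
      rintro x ⟨-, hx⟩ h0
      exact h (h0.symm.trans hx)
    rw [h0 h, h0 (Ne.symm h), mul_zero, mul_zero]
  | succ n ih =>
    rw [walkLaw_avoidUpTo_succ, walkLaw_avoidUpTo_succ', ← ENNReal.tsum_mul_left,
      ← ENNReal.tsum_mul_left]
    refine tsum_congr fun w ↦ ?_
    rw [← mul_assoc, ih, mul_right_comm, ← mul_assoc, stepLaw_comm]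
    ring

theorem avoidUpTo_empty (n : ℕ) (v : V) : avoidUpTo ∅ n v = {x | x n = v} := by
  simp [avoidUpTo]

theorem walkLaw_eval_comm (n : ℕ) (u v : V) :
    ((max (G.degree u) 1 : ℕ) : ℝ≥0∞) * G.walkLaw u {x | x n = v} =
      ((max (G.degree v) 1 : ℕ) : ℝ≥0∞) * G.walkLaw v {x | x n = u} := by
  simpa only [avoidUpTo_empty] using walkLaw_avoidUpTo_comm G ∅ n u v

end Meeting

end SimpleGraph

namespace SimpleGraph

/-! ### The mass received by a bad vertex is infinite. -/

section MassComputation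

variable {V : Type*} [MeasurableSpace V] [DiscreteMeasurableSpace V] [Countable V]
  (G : SimpleGraph V) [G.LocallyFinite]

theorem lintegral_tsum_mul {α ι : Type*} [Countable ι] [MeasurableSpace α] {μ : Measure α}
    (f : ι → α → ℝ≥0∞) (hf : ∀ i, Measurable (f i)) {g : α → ℝ≥0∞} (hg : Measurable g) :
    ∫⁻ a, (∑' i, f i a) * g a ∂μ = ∑' i, ∫⁻ a, f i a * g a ∂μ := by
  rw [← lintegral_tsum fun i ↦ ((hf i).fun_mul hg).aemeasurable]
  simp only [ENNReal.tsum_mul_right]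

theorem expectedIntersections_eq_tsum (u : V) (y : ℕ → V) :
    G.expectedIntersections u y = ∑' p : ℕ × ℕ, G.walkLaw u {x | x p.1 = y p.2} := by
  have h (x : ℕ → V) : ((intersectionTimes x y).encard : ℝ≥0∞) =
      ∑' p : ℕ × ℕ, {x : ℕ → V | x p.1 = y p.2}.indicator 1 x := by
    rw [← ENNReal.tsum_set_one, tsum_subtype (intersectionTimes x y) fun _ ↦ (1 : ℝ≥0∞)]
    rfl
  simp only [expectedIntersections, h]
  rw [lintegral_tsum (f := fun (p : ℕ × ℕ) (x : ℕ → V) ↦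
    {x : ℕ → V | x p.1 = y p.2}.indicator 1 x) fun p ↦
    (measurable_one.indicator (measurableSet_eval_eq p.1 (y p.2))).aemeasurable]
  refine tsum_congr fun p ↦ ?_
  rw [lintegral_indicator_one (measurableSet_eval_eq p.1 (y p.2))]

theorem map_restrict_shiftBy_walkLaw (u v : V) (n : ℕ) :
    ((G.walkLaw u).restrict {x | x n = v}).map (shiftBy n) =
      G.walkLaw u {x | x n = v} • G.walkLaw v := by
  ext A hA
  rw [Measure.map_apply (measurable_shiftBy n) hA,
    Measure.restrict_apply (measurable_shiftBy n hA), Set.inter_comm,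
    walkLaw_eval_inter_shiftBy G u v n hA, Measure.smul_apply, smul_eq_mul]

theorem lintegral_shiftBy (u v : V) (n : ℕ) {f : (ℕ → V) → ℝ≥0∞} (hf : Measurable f) :
    ∫⁻ x in {x | x n = v}, f (shiftBy n x) ∂G.walkLaw u =
      G.walkLaw u {x | x n = v} * ∫⁻ x, f x ∂G.walkLaw v := by
  rw [← lintegral_map hf (measurable_shiftBy n), map_restrict_shiftBy_walkLaw,
    lintegral_smul_measure, smul_eq_mul]

/-- The Markov property for two independent walks. -/
theorem prod_walkLaw_shiftBy (u u' v v' : V) (i j : ℕ) {A : Set ((ℕ → V) × (ℕ → V))}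
    (hA : MeasurableSet A) :
    (G.walkLaw u).prod (G.walkLaw u')
        {p | (p.1 i = v ∧ p.2 j = v') ∧ (shiftBy i p.1, shiftBy j p.2) ∈ A} =
      G.walkLaw u {x | x i = v} * G.walkLaw u' {x | x j = v'} *
        (G.walkLaw v).prod (G.walkLaw v') A := by
  have hm : Measurable (Prod.map (shiftBy (V := V) i) (shiftBy (V := V) j)) := by fun_prop
  have h : (((G.walkLaw u).prod (G.walkLaw u')).restrict ({x | x i = v} ×ˢ {x | x j = v'})).map
      (Prod.map (shiftBy i) (shiftBy j)) =
      (G.walkLaw u {x | x i = v} * G.walkLaw u' {x | x j = v'}) •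
        (G.walkLaw v).prod (G.walkLaw v') := by
    rw [← Measure.prod_restrict, ← Measure.map_prod_map _ _ (measurable_shiftBy i)
      (measurable_shiftBy j), map_restrict_shiftBy_walkLaw, map_restrict_shiftBy_walkLaw,
      Measure.prod_smul_left, Measure.prod_smul_right, smul_smul]
  have h' := congrArg (fun μ ↦ μ A) h
  simp only [Measure.map_apply hm hA, Measure.restrict_apply (hm hA), Measure.smul_apply,
    smul_eq_mul] at h'
  rw [← h', Set.inter_comm]
  rfl

theorem measurable_walkLaw_escape_laterTrace (u v : V) :
    Measurable fun y ↦ G.walkLaw u (escape (laterTrace y) v) :=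
  measurable_measure_prodMk_right (measurableSet_escape_laterTrace v)

theorem measurable_walkLaw_avoidUpTo_laterTrace (u v : V) (n : ℕ) :
    Measurable fun y ↦ G.walkLaw u (avoidUpTo (laterTrace y) n v) :=
  measurable_measure_prodMk_right (measurableSet_avoidUpTo_laterTrace n v)

/-- The second walk is constrained before time `j` only through its position at time `j`. Given its
future `y` from there, the first walk must avoid `laterTrace y` throughout; the Markov property
splits this at time `i`. -/
theorem prod_walkLaw_lastMeetingAt (u u' v : V) (i j : ℕ) :
    (G.walkLaw u).prod (G.walkLaw u') (lastMeetingAt i j v) =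
      G.walkLaw u' {y | y j = v} *
        ∫⁻ y, G.walkLaw u (avoidUpTo (laterTrace y) i v) * G.walkLaw v (escape (laterTrace y) v)
          ∂G.walkLaw v := by
  classical
  rw [Measure.prod_apply_symm (measurableSet_lastMeetingAt i j v),
    ← lintegral_shiftBy G u' v j ((measurable_walkLaw_avoidUpTo_laterTrace G u v i).fun_mul
      (measurable_walkLaw_escape_laterTrace G v v)),
    ← lintegral_indicator (measurableSet_eval_eq j v)]
  refine lintegral_congr fun y ↦ ?_
  rw [Set.indicator_apply]
  split_ifs with hy
  · rw [← walkLaw_inter_shiftBy G u v (determinedBy_avoidUpTo _ i v) (fun x hx ↦ hx.2)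
      (measurableSet_escape _ v)]
    congr 1
    ext x
    have hS (w : V) : w ∉ laterTrace (shiftBy j y) ↔ ∀ k > j, y k ≠ w := by
      constructor
      · rintro h k hk rfl
        exact h ⟨k - j, by lia, by simp [shiftBy, hk.le]⟩
      · rintro h ⟨k, hk, hkw⟩
        exact h (j + k) (by lia) hkw
    simp only [Set.mem_preimage, lastMeetingAt, Set.mem_inter_iff, avoidUpTo, escape,
      Set.mem_ofPred_eq, hS, shiftBy]
    constructor
    · rintro ⟨h1, -, h3, h4⟩
      exact ⟨⟨fun l _ k hk ↦ h3 k hk l, h1⟩, fun l k hk ↦ h3 k hk _, fun l hl ↦ h4 _ (by lia)⟩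
    · rintro ⟨⟨h1, h2⟩, h3, h4⟩
      refine ⟨h2, hy, fun k hk l ↦ ?_, fun l hl ↦ ?_⟩
      · rcases le_or_gt l i with hl | hl
        · exact h1 l hl k hk
        · obtain ⟨m, rfl⟩ := Nat.exists_eq_add_of_le hl.le
          exact h3 m k hk
      · obtain ⟨m, rfl⟩ := Nat.exists_eq_add_of_le hl.le
        exact h4 m (by lia)
  · convert measure_empty (μ := G.walkLaw u)
    ext x
    simp only [Set.mem_preimage, Set.mem_empty_iff_false, iff_false]
    exact fun h ↦ hy h.2.1

theorem lintegral_escape_le_tsum (v : V) (S : Set V) (i j : ℕ) :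
    ∫⁻ z in {z | ∀ l, z l ∉ S}, G.walkLaw v {w | w j = z i} ∂G.walkLaw v ≤
      ∑' u, G.walkLaw v {w | w j = u} * G.walkLaw v (avoidUpTo S i u) := by
  classical
  have hm (u : V) : MeasurableSet {z : ℕ → V | z i = u} := measurableSet_eval_eq i u
  have h (z : ℕ → V) : G.walkLaw v {w | w j = z i} =
      ∑' u, {z : ℕ → V | z i = u}.indicator (fun _ ↦ G.walkLaw v {w | w j = u}) z := by
    rw [tsum_eq_single (z i)]
    · simp
    · intro u hu
      simp [Ne.symm hu]
  simp only [h]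
  rw [lintegral_tsum fun u ↦ (measurable_const.indicator (hm u)).aemeasurable]
  refine ENNReal.tsum_le_tsum fun u ↦ ?_
  rw [lintegral_indicator_const (hm u), Measure.restrict_apply (hm u)]
  gcongr
  rintro z ⟨hz, hz'⟩
  exact ⟨fun l _ ↦ hz' l, hz⟩

/-- Restricted to the event that `z` avoids `S` for ever, the expected number of meetings with an
independent walk `w` is still infinite, because it is infinite for almost every `z`. Relaxing the
constraint to avoidance up to the meeting time gives the right-hand side. -/
theorem top_mul_walkLaw_escape_le (v : V)
    (hv : ∀ᵐ y ∂G.walkLaw v, G.expectedIntersections v y = ∞) (S : Set V) :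
    ∞ * G.walkLaw v (escape S v) ≤
      ∑' p : ℕ × ℕ, ∑' u, G.walkLaw v {w | w p.2 = u} * G.walkLaw v (avoidUpTo S p.1 u) := by
  have hm (p : ℕ × ℕ) : Measurable fun z : ℕ → V ↦ G.walkLaw v {w | w p.2 = z p.1} :=
    (Measurable.of_discrete (f := fun c ↦ G.walkLaw v {w | w p.2 = c})).comp
      (measurable_pi_apply _)
  calc ∞ * G.walkLaw v (escape S v)
      ≤ ∞ * G.walkLaw v {z | ∀ l, z l ∉ S} := by gcongr; exact fun z hz ↦ hz.1
    _ = ∫⁻ z in {z | ∀ l, z l ∉ S}, G.expectedIntersections v z ∂G.walkLaw v := by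
        rw [lintegral_congr_ae (ae_restrict_of_ae hv), setLIntegral_const]
    _ = ∑' p : ℕ × ℕ, ∫⁻ z in {z | ∀ l, z l ∉ S}, G.walkLaw v {w | w p.2 = z p.1}
          ∂G.walkLaw v := by
        rw [← lintegral_tsum fun p ↦ (hm p).aemeasurable]
        refine lintegral_congr fun z ↦ ?_
        -- `expectedIntersections` lists the time of the averaged walk first, whereas here `p.1` is
        -- the time of `z`.
        rw [expectedIntersections_eq_tsum, ← (Equiv.prodComm ℕ ℕ).tsum_eq]
        rfl
    _ ≤ _ := ENNReal.tsum_le_tsum fun p ↦ lintegral_escape_le_tsum G v S p.1 p.2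

/-- One degree factor reverses the first `j` steps of the second walk, the other the first `i` steps
of the first walk, killed on `laterTrace y`. -/
theorem sq_mul_prod_walkLaw_lastMeetingAt (u v : V) (i j : ℕ) :
    ((max (G.degree u) 1 : ℕ) : ℝ≥0∞) ^ 2 *
        (G.walkLaw u).prod (G.walkLaw u) (lastMeetingAt i j v) =
      ((max (G.degree v) 1 : ℕ) : ℝ≥0∞) ^ 2 *
        ∫⁻ y, G.walkLaw v {w | w j = u} * G.walkLaw v (avoidUpTo (laterTrace y) i u) *
          G.walkLaw v (escape (laterTrace y) v) ∂G.walkLaw v := by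
  have hm := measurable_walkLaw_escape_laterTrace G v v
  have hm' := measurable_walkLaw_avoidUpTo_laterTrace G v u i
  have hm'' := measurable_walkLaw_avoidUpTo_laterTrace G u v i
  rw [prod_walkLaw_lastMeetingAt, sq, mul_mul_mul_comm, walkLaw_eval_comm,
    ← lintegral_const_mul _ (hm''.fun_mul hm)]
  simp only [← mul_assoc, walkLaw_avoidUpTo_comm G _ i u v]
  simp only [mul_assoc]
  rw [lintegral_const_mul _ (by fun_prop), lintegral_const_mul _ (by fun_prop), sq]
  ring

theorem tsum_sq_mul_prod_walkLaw_lastMeetingAt_eq_top (v : V)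
    (hv : ∀ᵐ y ∂G.walkLaw v, G.expectedIntersections v y = ∞)
    (h : (G.walkLaw v).prod (G.walkLaw v) (lastMeetingAt 0 0 v) ≠ 0) :
    ∑' u, ((max (G.degree u) 1 : ℕ) : ℝ≥0∞) ^ 2 *
      (G.walkLaw u).prod (G.walkLaw u) (⋃ p : ℕ × ℕ, lastMeetingAt p.1 p.2 v) = ∞ := by
  have hm := measurable_walkLaw_escape_laterTrace G v v
  have hm' (u : V) (i : ℕ) := measurable_walkLaw_avoidUpTo_laterTrace G v u i
  have hd : Pairwise (Function.onFun Disjoint fun p : ℕ × ℕ ↦ lastMeetingAt p.1 p.2 v) :=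
    fun p q hpq ↦ pairwise_disjoint_lastMeetingAt (i := (p, v)) (j := (q, v))
      fun h ↦ hpq (congrArg Prod.fst h)
  -- Badness of `v` forces a positive averaged escape probability, which is then multiplied by an
  -- infinite sum.
  have hq : ∫⁻ y, G.walkLaw v (escape (laterTrace y) v) ∂G.walkLaw v ≠ 0 := by
    contrapose! h
    rw [lintegral_eq_zero_iff hm] at h
    rw [prod_walkLaw_lastMeetingAt]
    refine mul_eq_zero_of_right _ ?_
    rw [lintegral_eq_zero_iff ((hm' v 0).fun_mul hm)]
    filter_upwards [h] with y hy
    rw [hy]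
    simp
  simp only [measure_iUnion hd fun p ↦ measurableSet_lastMeetingAt p.1 p.2 v,
    ← ENNReal.tsum_mul_left, sq_mul_prod_walkLaw_lastMeetingAt G _ v]
  rw [ENNReal.tsum_comm]
  simp only [ENNReal.tsum_mul_left]
  have hsum : ∑' p : ℕ × ℕ, ∑' u, ∫⁻ y, G.walkLaw v {w | w p.2 = u} *
      G.walkLaw v (avoidUpTo (laterTrace y) p.1 u) *
        G.walkLaw v (escape (laterTrace y) v) ∂G.walkLaw v = ∞ := by
    simp only [← lintegral_tsum_mul _ (fun u ↦ (hm' u _).const_mul _) hm]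
    rw [← lintegral_tsum_mul (fun (p : ℕ × ℕ) y ↦ ∑' u, G.walkLaw v {w | w p.2 = u} *
      G.walkLaw v (avoidUpTo (laterTrace y) p.1 u))
      (fun p ↦ Measurable.tsum fun u ↦ (hm' u p.1).const_mul _) hm]
    refine top_le_iff.1 ?_
    calc ∞ = ∞ * ∫⁻ y, G.walkLaw v (escape (laterTrace y) v) ∂G.walkLaw v :=
          (ENNReal.top_mul hq).symm
      _ = ∫⁻ y, ∞ * G.walkLaw v (escape (laterTrace y) v) ∂G.walkLaw v :=
          (lintegral_const_mul _ hm).symm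
      _ ≤ _ := by
          refine lintegral_mono fun y ↦ ?_
          dsimp only
          have := top_mul_walkLaw_escape_le G v hv (laterTrace y)
          rcases eq_or_ne (G.walkLaw v (escape (laterTrace y) v)) 0 with h0 | h0
          · simp [h0]
          · rw [ENNReal.top_mul h0] at this ⊢
            rw [top_le_iff.1 this, ENNReal.top_mul h0]
  rw [hsum, ENNReal.mul_top]
  simp

end MassComputation

end SimpleGraph

namespace SimpleGraph

/-! ### The infinite intersection property in the absence of bad vertices. -/

section InfiniteIntersection

variable {V : Type*} [MeasurableSpace V] [DiscreteMeasurableSpace V] [Countable V]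
  (G : SimpleGraph V) [G.LocallyFinite]

theorem stepLaw_ne_zero {u v : V} (h : G.Adj u v) : G.stepLaw u v ≠ 0 := by
  have hv : v ∈ G.neighborFinset u := (G.mem_neighborFinset u v).2 h
  rw [stepLaw, dif_pos ⟨v, hv⟩]
  exact (PMF.mem_support_iff _ _).1 ((PMF.mem_support_uniformOfFinset_iff _ _).2 hv)

/-- If the walk started at `z` may fail to return to `z`, then `z` is visited only finitely often
by the walk from any starting point. -/
theorem walkLaw_setOf_infinite_visits_eq_zero {z : V}
    (hz : G.walkLaw z {x | ∀ l > 0, x l ≠ z} ≠ 0) (w : V) :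
    G.walkLaw w {y | {j | y j = z}.Infinite} = 0 := by
  have hm : MeasurableSet {x : ℕ → V | ∀ l > 0, x l ≠ z} :=
    measurableSet_setOfPred.2 <| .forall fun l ↦ .forall fun _ ↦ (measurable_eval_eq l z).not
  -- Event `j` says that the last visit to `z` is at time `j`. Disjointness bounds the expected
  -- number of visits by the inverse of the escape probability, and Borel–Cantelli applies.
  have hd : Pairwise (Function.onFun Disjoint fun j : ℕ ↦
      {y : ℕ → V | y j = z} ∩ shiftBy j ⁻¹' {x | ∀ l > 0, x l ≠ z}) := by
    refine (pairwise_disjoint_on _).2 fun i j hij ↦ Set.disjoint_left.2 ?_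
    rintro y ⟨-, hy⟩ ⟨hy', -⟩
    have := hy (j - i) (by lia)
    rw [shiftBy, Nat.add_sub_cancel' hij.le] at this
    exact this hy'
  have hsum : (∑' j, G.walkLaw w {y | y j = z}) * G.walkLaw z {x | ∀ l > 0, x l ≠ z} ≤ 1 := by
    simp only [← ENNReal.tsum_mul_right, ← walkLaw_eval_inter_shiftBy G w z _ hm]
    rw [← measure_iUnion hd fun j ↦ (measurableSet_eval_eq j z).inter (measurable_shiftBy j hm)]
    exact prob_le_one
  have hfin : ∑' j, G.walkLaw w {y | y j = z} ≠ ∞ := by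
    intro h
    rw [h, ENNReal.top_mul hz] at hsum
    exact absurd hsum (by simp)
  have := measure_setOfPred_frequently_eq_zero (p := fun j (y : ℕ → V) ↦ y j = z) hfin
  simpa only [Nat.frequently_atTop_iff_infinite] using this

theorem measurableSet_intersectionTimes_eq_empty :
    MeasurableSet {p : (ℕ → V) × (ℕ → V) | intersectionTimes p.1 p.2 = ∅} := by
  have h : {p : (ℕ → V) × (ℕ → V) | intersectionTimes p.1 p.2 = ∅} =
      {p | ∀ i j, ¬ p.1 i = p.2 j} := by
    ext p
    simp [intersectionTimes, Set.eq_empty_iff_forall_notMem]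
  rw [h]
  exact measurableSet_setOfPred.2 <| .forall fun i ↦ .forall fun j ↦ (measurable_pos_eq i j).not

/-- Maximise the time of the second trajectory first, then that of the first trajectory among the
pairs attaining this maximum. -/
theorem exists_last_meeting {x y : ℕ → V} (hf : (intersectionTimes x y).Finite)
    (hne : (intersectionTimes x y).Nonempty) : ∃ i j v, x i = v ∧ y j = v ∧
      (shiftBy i x, shiftBy j y) ∈ lastMeetingAt 0 0 v := by
  obtain ⟨⟨i₀, j⟩, hj, hjmax⟩ := Set.exists_max_image _ Prod.snd hf hne
  obtain ⟨⟨i, j'⟩, ⟨hi, rfl⟩, himax⟩ := Set.exists_max_image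
    (intersectionTimes x y ∩ {p | p.2 = j}) Prod.fst (hf.inter_of_left _) ⟨_, hj, rfl⟩
  refine ⟨i, j', y j', hi, rfl, hi, rfl, fun k hk l hkl ↦ ?_, fun l hl hkl ↦ ?_⟩
  · have := hjmax (i + l, j' + k) hkl.symm
    dsimp only at this
    lia
  · have := himax (i + l, j') ⟨hkl, rfl⟩
    dsimp only at this
    lia

variable {G}

theorem ae_infinite_or_eq_empty
    (h : ∀ v, (G.walkLaw v).prod (G.walkLaw v) (lastMeetingAt 0 0 v) = 0) (u w : V) :
    ∀ᵐ p ∂(G.walkLaw u).prod (G.walkLaw w),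
      (intersectionTimes p.1 p.2).Infinite ∨ intersectionTimes p.1 p.2 = ∅ := by
  have h0 (i j : ℕ) (v : V) : ∀ᵐ p ∂(G.walkLaw u).prod (G.walkLaw w),
      ¬ ((p.1 i = v ∧ p.2 j = v) ∧ (shiftBy i p.1, shiftBy j p.2) ∈ lastMeetingAt 0 0 v) := by
    rw [ae_iff]
    simp only [not_not]
    rw [prod_walkLaw_shiftBy G u w v v i j (measurableSet_lastMeetingAt 0 0 v), h, mul_zero]
  filter_upwards [ae_all_iff.2 fun i ↦ ae_all_iff.2 fun j ↦ ae_all_iff.2 (h0 i j)] with p hp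
  by_contra! hc
  obtain ⟨i, j, v, hi, hj, hl⟩ := exists_last_meeting hc.1 hc.2
  exact hp i j v ⟨⟨hi, hj⟩, hl⟩

/-- Walks from `z` and `w` meet infinitely often. If the first steps to `x` and from then on never
meets the second, all meetings are at its time `0`. So the second walk visits `z` infinitely often
while the first does not return to `z`, which has probability zero. -/
theorem prod_walkLaw_eq_empty_of_adj
    (h : ∀ v, (G.walkLaw v).prod (G.walkLaw v) (lastMeetingAt 0 0 v) = 0) {x z w : V}
    (hadj : G.Adj z x)
    (hz : (G.walkLaw z).prod (G.walkLaw w) {p | intersectionTimes p.1 p.2 = ∅} = 0) :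
    (G.walkLaw x).prod (G.walkLaw w) {p | intersectionTimes p.1 p.2 = ∅} = 0 := by
  have hB := prod_walkLaw_shiftBy G z w x w 1 0
    (measurableSet_intersectionTimes_eq_empty (V := V))
  have h0 : (G.walkLaw z).prod (G.walkLaw w) {p | (p.1 1 = x ∧ p.2 0 = w) ∧
      (shiftBy 1 p.1, shiftBy 0 p.2) ∈ {p | intersectionTimes p.1 p.2 = ∅}} = 0 := by
    -- Either return to `z` is almost sure, which kills the first factor, or `z` is transient, which
    -- kills the second.
    have hprod : (G.walkLaw z).prod (G.walkLaw w)
        ({x | ∀ l > 0, x l ≠ z} ×ˢ {y | {j | y j = z}.Infinite}) = 0 := by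
      rw [Measure.prod_prod]
      by_cases hr : G.walkLaw z {x | ∀ l > 0, x l ≠ z} = 0
      · rw [hr, zero_mul]
      · rw [walkLaw_setOf_infinite_visits_eq_zero G hr, mul_zero]
    rw [← nonpos_iff_eq_zero, ← hprod]
    refine measure_mono_ae ?_
    have hne : ∀ᵐ p ∂(G.walkLaw z).prod (G.walkLaw w), ¬ intersectionTimes p.1 p.2 = ∅ := by
      rw [ae_iff]
      simpa only [not_not] using hz
    filter_upwards [ae_infinite_or_eq_empty h z w, hne,
      Measure.quasiMeasurePreserving_fst.ae (walkLaw_start G z)] with p hp hp' hstart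
    rintro ⟨-, hE⟩
    have hE' (i j : ℕ) : p.1 (1 + i) ≠ p.2 j := by
      intro hij
      have : (i, j) ∈ intersectionTimes (shiftBy 1 p.1) (shiftBy 0 p.2) := by
        simpa [intersectionTimes, shiftBy] using hij
      rw [show intersectionTimes (shiftBy 1 p.1) (shiftBy 0 p.2) = ∅ from hE] at this
      exact this
    have hinf := hp.resolve_right hp'
    have hsub : intersectionTimes p.1 p.2 ⊆ (fun j ↦ (0, j)) '' {j | p.2 j = z} := by
      rintro ⟨i, j⟩ (hij : p.1 i = p.2 j)
      rcases i with - | i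
      · exact ⟨j, hij.symm.trans hstart, rfl⟩
      · exact (hE' i j (by rwa [add_comm])).elim
    have hvis : {j | p.2 j = z}.Infinite := (hinf.mono hsub).of_image _
    obtain ⟨j, hj⟩ := hvis.nonempty
    refine ⟨fun l hl hlz ↦ hE' (l - 1) j ?_, hvis⟩
    rw [Nat.add_sub_cancel' hl, hlz]
    exact hj.symm
  rw [h0, walkLaw_one] at hB
  have hw : G.walkLaw w {x | x 0 = w} = 1 :=
    (prob_compl_eq_zero_iff (measurableSet_eval_eq 0 w)).1 (walkLaw_start G w)
  rw [hw, mul_one] at hB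
  exact (mul_eq_zero.1 hB.symm).resolve_left (stepLaw_ne_zero G hadj)

theorem hasInfiniteIntersectionProperty_of_lastMeetingAt (hG : G.Connected)
    (h : ∀ v, (G.walkLaw v).prod (G.walkLaw v) (lastMeetingAt 0 0 v) = 0) :
    G.HasInfiniteIntersectionProperty := by
  intro u w
  have hempty : (G.walkLaw u).prod (G.walkLaw w) {p | intersectionTimes p.1 p.2 = ∅} = 0 := by
    obtain ⟨γ⟩ := hG.preconnected u w
    induction γ with
    | nil =>
      rename_i u
      refine measure_mono_null (t := {p | ¬ (p.1 0 = u ∧ p.2 0 = u)}) ?_ ?_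
      · rintro p hp ⟨h1, h2⟩
        have : ((0 : ℕ), (0 : ℕ)) ∈ intersectionTimes p.1 p.2 := h1.trans h2.symm
        rw [show intersectionTimes p.1 p.2 = ∅ from hp] at this
        exact this
      · exact (Measure.quasiMeasurePreserving_fst.ae (walkLaw_start G u)).and
          (Measure.quasiMeasurePreserving_snd.ae (walkLaw_start G u))
    | cons hadj _ ih => exact prod_walkLaw_eq_empty_of_adj h hadj.symm ih
  have hne : ∀ᵐ p ∂(G.walkLaw u).prod (G.walkLaw w), ¬ intersectionTimes p.1 p.2 = ∅ := by
    rw [ae_iff]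
    simpa only [not_not] using hempty
  filter_upwards [ae_infinite_or_eq_empty h u w, hne] with p hp hp'
  exact hp.resolve_right hp'

end InfiniteIntersection

end SimpleGraph

namespace SimpleGraph

variable {V : Type*} [MeasurableSpace V] [DiscreteMeasurableSpace V] [Countable V]

theorem walkLaw_step (G : SimpleGraph V) [G.LocallyFinite] (u : V) :
    ∀ᵐ x ∂G.walkLaw u, ∀ n, x n = x (n + 1) ∨ G.Adj (x n) (x (n + 1)) := by
  refine ae_all_iff.2 fun n ↦ ?_
  have h (v w : V) (hvw : ¬ (v = w ∨ G.Adj v w)) :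
      ∀ᵐ x ∂G.walkLaw u, ¬ (x n = v ∧ x (n + 1) = w) := by
    rw [ae_iff]
    simp only [not_not]
    have h1 := walkLaw_eval_inter_shiftBy G u v n (measurableSet_eval_eq 1 w)
    have h2 : G.stepLaw v w = 0 := by
      rw [not_or] at hvw
      rw [stepLaw]
      split_ifs
      · rw [PMF.uniformOfFinset_apply, if_neg]
        rw [mem_neighborFinset]
        exact hvw.2
      · rw [PMF.pure_apply, if_neg (Ne.symm hvw.1)]
    rw [walkLaw_one, h2, mul_zero] at h1
    exact h1
  have h' : ∀ᵐ x ∂G.walkLaw u, ∀ v w, ¬ (v = w ∨ G.Adj v w) → ¬ (x n = v ∧ x (n + 1) = w) :=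
    ae_all_iff.2 fun v ↦ ae_all_iff.2 fun w ↦ by
      by_cases hvw : v = w ∨ G.Adj v w
      · exact .of_forall fun _ hn ↦ (hn hvw).elim
      · filter_upwards [h v w hvw] with x hx _ using hx
  filter_upwards [h'] with x hx
  by_contra hc
  exact hx _ _ hc ⟨rfl, rfl⟩

end SimpleGraph

/-! ### The walk up to time `r` is determined by the ball of radius `r`. -/

namespace RootedGraph

open Preorder

variable {k : ℕ}

instance (g : RootedGraph k) : Countable g.V :=
  g.connected.countable_of_locallyFinite g.finite_neighborSet

theorem ball_mono (g : RootedGraph k) {r s : ℕ} (h : r ≤ s) : g.ball r ⊆ g.ball s :=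
  fun _ ⟨i, hi⟩ ↦ ⟨i, hi.trans h⟩

theorem mem_ball_succ {g : RootedGraph k} {r : ℕ} {v w : g.V} (hv : v ∈ g.ball r)
    (h : g.graph.Adj v w) : w ∈ g.ball (r + 1) := by
  obtain ⟨i, hi⟩ := hv
  refine ⟨i, (g.connected.dist_triangle (v := v)).trans ?_⟩
  rw [SimpleGraph.dist_eq_one_iff_adj.2 h]
  lia

theorem BallIso.refl (r : ℕ) (g : RootedGraph k) : BallIso r g g := ⟨.refl, fun _ ↦ rfl⟩

/-- A map of vertices that restricts to an isomorphism between the balls of radius `r`. -/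
structure IsBallIso (r : ℕ) (g h : RootedGraph k) (ψ : g.V → h.V) : Prop where
  bijOn : Set.BijOn ψ (g.ball r) (h.ball r)
  map_root : ∀ i, ψ (g.root i) = h.root i
  adj_iff : ∀ v ∈ g.ball r, ∀ w ∈ g.ball r, h.graph.Adj (ψ v) (ψ w) ↔ g.graph.Adj v w

theorem BallIso.exists_isBallIso {r : ℕ} {g h : RootedGraph k} (H : BallIso r g h) :
    ∃ ψ, IsBallIso r g h ψ := by
  classical
  obtain ⟨φ, hφ⟩ := H
  obtain ⟨v₀⟩ := h.connected.nonempty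
  let ψ : g.V → h.V := fun v ↦ if hv : v ∈ g.ball r then (φ ⟨v, hv⟩).1 else v₀
  have hψ {v : g.V} (hv : v ∈ g.ball r) : ψ v = (φ ⟨v, hv⟩).1 := dif_pos hv
  refine ⟨ψ, ⟨fun v hv ↦ ?_, fun v hv w hw hvw ↦ ?_, fun v hv ↦ ?_⟩, fun i ↦ ?_,
    fun v hv w hw ↦ ?_⟩
  · rw [hψ hv]
    exact (φ _).2
  · rw [hψ hv, hψ hw] at hvw
    exact congrArg Subtype.val (φ.injective (Subtype.ext hvw))
  · obtain ⟨⟨w, hw⟩, hwv⟩ := φ.surjective ⟨v, hv⟩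
    exact ⟨w, hw, by rw [hψ hw, hwv]⟩
  · rw [hψ (g.root_mem_ball r i), hφ]
  · rw [hψ hv, hψ hw]
    exact φ.map_adj_iff (v := ⟨v, hv⟩) (w := ⟨w, hw⟩)

namespace IsBallIso

variable {r : ℕ} {g h : RootedGraph k} {ψ : g.V → h.V}

/-- All neighbours of a vertex of the ball of radius `s < r` lie in the ball of radius `r`.
Membership of `ψ v` is a separate assumption because `ψ` is not known to preserve the distance to
the roots. -/
theorem neighborFinset_eq [DecidableEq h.V] (H : IsBallIso r g h ψ) {s : ℕ} (hs : s < r)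
    {v : g.V} (hv : v ∈ g.ball s) (hv' : ψ v ∈ h.ball s) :
    h.graph.neighborFinset (ψ v) = (g.graph.neighborFinset v).image ψ := by
  ext w
  simp only [SimpleGraph.mem_neighborFinset, Finset.mem_image]
  constructor
  · intro hw
    obtain ⟨w, hwr, rfl⟩ := H.bijOn.surjOn (h.ball_mono hs (mem_ball_succ hv' hw))
    exact ⟨w, (H.adj_iff v (g.ball_mono hs.le hv) w hwr).1 hw, rfl⟩
  · rintro ⟨w, hw, rfl⟩
    exact (H.adj_iff v (g.ball_mono hs.le hv) w (g.ball_mono hs (mem_ball_succ hv hw))).2 hw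

theorem injOn_neighborFinset (H : IsBallIso r g h ψ) {s : ℕ} (hs : s < r)
    {v : g.V} (hv : v ∈ g.ball s) : Set.InjOn ψ (g.graph.neighborFinset v) :=
  H.bijOn.injOn.mono fun _ hw ↦ g.ball_mono hs
    (mem_ball_succ hv ((g.graph.mem_neighborFinset _ _).1 (Finset.mem_coe.1 hw)))

theorem degree_eq (H : IsBallIso r g h ψ) {s : ℕ} (hs : s < r)
    {v : g.V} (hv : v ∈ g.ball s) (hv' : ψ v ∈ h.ball s) :
    h.graph.degree (ψ v) = g.graph.degree v := by
  classical
  rw [← SimpleGraph.card_neighborFinset_eq_degree, H.neighborFinset_eq hs hv hv',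
    Finset.card_image_of_injOn (H.injOn_neighborFinset hs hv),
    SimpleGraph.card_neighborFinset_eq_degree]

theorem stepLaw_eq (H : IsBallIso r g h ψ) {s : ℕ} (hs : s < r)
    {v : g.V} (hv : v ∈ g.ball s) (hv' : ψ v ∈ h.ball s) :
    h.graph.stepLaw (ψ v) = (g.graph.stepLaw v).map ψ := by
  classical
  have hN := H.neighborFinset_eq hs hv hv'
  by_cases hne : (g.graph.neighborFinset v).Nonempty
  · have hne' : (h.graph.neighborFinset (ψ v)).Nonempty := by rw [hN]; exact hne.image _
    rw [SimpleGraph.stepLaw, SimpleGraph.stepLaw, dif_pos hne, dif_pos hne']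
    ext w
    rw [PMF.map_apply, PMF.uniformOfFinset_apply]
    simp only [PMF.uniformOfFinset_apply]
    by_cases hw : w ∈ h.graph.neighborFinset (ψ v)
    · rw [if_pos hw]
      rw [hN] at hw
      obtain ⟨w, hwv, rfl⟩ := Finset.mem_image.1 hw
      rw [tsum_eq_single w, if_pos rfl, if_pos hwv, hN,
        Finset.card_image_of_injOn (H.injOn_neighborFinset hs hv)]
      intro w' hw'
      split_ifs with h1 h2
      · exact (hw' (H.injOn_neighborFinset hs hv h2 hwv h1.symm)).elim
      all_goals rfl
    · rw [if_neg hw, eq_comm, ENNReal.tsum_eq_zero]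
      intro w'
      split_ifs with h1 h2
      · exact (hw (h1 ▸ hN ▸ Finset.mem_image_of_mem _ h2)).elim
      all_goals rfl
  · have hne' : ¬ (h.graph.neighborFinset (ψ v)).Nonempty := by
      rw [hN]
      simpa using hne
    rw [SimpleGraph.stepLaw, SimpleGraph.stepLaw, dif_neg hne, dif_neg hne', PMF.pure_map]

theorem walkLaw_mem_ball (H : IsBallIso r g h ψ) (i : Fin k) :
    ∀ᵐ x ∂g.graph.walkLaw (g.root i), ∀ n ≤ r, x n ∈ g.ball n ∧ ψ (x n) ∈ h.ball n := by
  filter_upwards [SimpleGraph.walkLaw_start g.graph (g.root i),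
    SimpleGraph.walkLaw_step g.graph (g.root i)] with x h0 hx n hn
  induction n with
  | zero =>
    rw [h0, H.map_root]
    exact ⟨g.root_mem_ball 0 i, h.root_mem_ball 0 i⟩
  | succ n ih =>
    obtain ⟨h1, h2⟩ := ih (by lia)
    rcases hx n with he | ha
    · rw [← he]
      exact ⟨g.ball_mono n.le_succ h1, h.ball_mono n.le_succ h2⟩
    · have h3 := mem_ball_succ h1 ha
      exact ⟨h3, mem_ball_succ h2 ((H.adj_iff _ (g.ball_mono (by lia) h1) _
        (g.ball_mono hn h3)).2 ha)⟩

theorem walkLaw_pathCylinder (H : IsBallIso r g h ψ) (i : Fin k) (b : ℕ → h.V) {n : ℕ}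
    (hn : n ≤ r) :
    g.graph.walkLaw (g.root i) {x | ∀ j ≤ n, ψ (x j) = b j} =
      h.graph.walkLaw (h.root i) (SimpleGraph.pathCylinder b n) := by
  classical
  induction n with
  | zero =>
    rw [SimpleGraph.walkLaw_pathCylinder_zero]
    have h1 : g.graph.walkLaw (g.root i) {x | ∀ j ≤ 0, ψ (x j) = b j} =
        g.graph.walkLaw (g.root i) {_x | h.root i = b 0} := by
      refine measure_congr ?_
      filter_upwards [SimpleGraph.walkLaw_start g.graph (g.root i)] with x hx
      refine propext ⟨fun h0 ↦ ?_, fun (h0 : h.root i = b 0) j hj ↦ ?_⟩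
      · have := h0 0 le_rfl
        rwa [hx, H.map_root] at this
      · obtain rfl := Nat.le_zero.1 hj
        rw [hx, H.map_root, h0]
    rw [h1]
    split_ifs with hb <;> simp [hb]
  | succ n ih =>
    rw [SimpleGraph.walkLaw_pathCylinder_succ, ← ih (by lia),
      SimpleGraph.measure_eq_tsum_inter_preimage _ (measurable_pi_apply n),
      SimpleGraph.measure_eq_tsum_inter_preimage (g.graph.walkLaw (g.root i))
        (measurable_pi_apply n) {x | ∀ j ≤ n, ψ (x j) = b j}, ← ENNReal.tsum_mul_right]
    refine tsum_congr fun w ↦ ?_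
    have hdet : SimpleGraph.DeterminedBy
        ({x : ℕ → g.V | ∀ j ≤ n, ψ (x j) = b j} ∩ (fun x ↦ x n) ⁻¹' {w}) n := by
      rintro x y hxy ⟨h1, h2⟩
      exact ⟨fun j hj ↦ hxy j hj ▸ h1 j hj, (hxy n le_rfl).symm.trans h2⟩
    have hm : MeasurableSet {x : ℕ → g.V | ψ (x 1) = b (n + 1)} :=
      measurable_pi_apply (X := fun _ ↦ g.V) 1 (.of_discrete (s := {v | ψ v = b (n + 1)}))
    have hset : {x : ℕ → g.V | ∀ j ≤ n + 1, ψ (x j) = b j} ∩ (fun x ↦ x n) ⁻¹' {w} =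
        ({x : ℕ → g.V | ∀ j ≤ n, ψ (x j) = b j} ∩ (fun x ↦ x n) ⁻¹' {w}) ∩
          SimpleGraph.shiftBy n ⁻¹' {x | ψ (x 1) = b (n + 1)} := by
      ext x
      constructor
      · rintro ⟨h1, h2⟩
        exact ⟨⟨fun j hj ↦ h1 j (by lia), h2⟩, h1 _ le_rfl⟩
      · rintro ⟨⟨h1, h2⟩, h3⟩
        refine ⟨fun j hj ↦ ?_, h2⟩
        rcases Nat.le_succ_iff.1 hj with hj | rfl
        · exact h1 j hj
        · exact h3
    rw [hset, SimpleGraph.walkLaw_inter_shiftBy g.graph _ w hdet (fun x hx ↦ hx.2) hm]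
    -- In the remaining case the walk is almost surely not at `w` at time `n` within the event, and
    -- both sides vanish.
    by_cases hw : w ∈ g.ball n ∧ ψ w ∈ h.ball n ∧ ψ w = b n
    · congr 1
      rw [← hw.2.2, H.stepLaw_eq (Nat.lt_of_succ_le hn) hw.1 hw.2.1,
        ← PMF.toMeasure_apply_singleton _ _ (measurableSet_singleton _),
        ← PMF.toMeasure_map _ _ .of_discrete,
        Measure.map_apply .of_discrete (measurableSet_singleton _)]
      change _ = g.graph.stepKernel w _
      rw [SimpleGraph.measure_eq_tsum_inter_preimage (g.graph.walkLaw w)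
        (measurable_pi_apply 1), SimpleGraph.measure_eq_tsum_inter_preimage _ measurable_id]
      refine tsum_congr fun v ↦ ?_
      by_cases hv : ψ v = b (n + 1)
      · have e1 : {x : ℕ → g.V | ψ (x 1) = b (n + 1)} ∩ (fun x ↦ x 1) ⁻¹' {v} =
            {x | x 1 = v} := by
          ext x
          exact ⟨fun hx ↦ hx.2, fun (hx : x 1 = v) ↦ ⟨(congrArg ψ hx).trans hv, hx⟩⟩
        have e2 : ψ ⁻¹' {b (n + 1)} ∩ id ⁻¹' {v} = {v} := by
          ext x
          exact ⟨fun hx ↦ hx.2, fun (hx : x = v) ↦ ⟨hx ▸ hv, hx⟩⟩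
        rw [e1, e2, SimpleGraph.walkLaw_one, SimpleGraph.stepKernel_singleton]
      · have e1 : {x : ℕ → g.V | ψ (x 1) = b (n + 1)} ∩ (fun x ↦ x 1) ⁻¹' {v} = ∅ := by
          ext x
          exact ⟨fun hx ↦ hv (hx.2 ▸ hx.1), fun hx ↦ hx.elim⟩
        have e2 : ψ ⁻¹' {b (n + 1)} ∩ id ⁻¹' {v} = ∅ := by
          ext x
          exact ⟨fun hx ↦ hv (hx.2 ▸ hx.1), fun hx ↦ hx.elim⟩
        rw [e1, e2, measure_empty, measure_empty]
    · have h0 : g.graph.walkLaw (g.root i)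
          ({x | ∀ j ≤ n, ψ (x j) = b j} ∩ (fun x ↦ x n) ⁻¹' {w}) = 0 := by
        rw [measure_eq_zero_iff_ae_notMem]
        filter_upwards [H.walkLaw_mem_ball i] with x hx
        rintro ⟨h1, h2 : x n = w⟩
        subst h2
        exact hw ⟨(hx n (by lia)).1, (hx n (by lia)).2, h1 n le_rfl⟩
      rw [h0, zero_mul, zero_mul]

theorem walkLaw_map_frestrictLe (H : IsBallIso r g h ψ) (i : Fin k) :
    ((g.graph.walkLaw (g.root i)).map fun x j ↦ ψ (x j)).map (frestrictLe r) =
      (h.graph.walkLaw (h.root i)).map (frestrictLe r) := by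
  have hm : Measurable fun (x : ℕ → g.V) j ↦ ψ (x j) :=
    measurable_pi_lambda _ fun j ↦
      (Measurable.of_discrete (f := ψ)).comp (measurable_pi_apply j)
  refine Measure.ext_of_singleton fun b ↦ ?_
  obtain ⟨b, rfl⟩ : ∃ a : ℕ → h.V, frestrictLe r a = b := by
    refine ⟨fun j ↦ if hj : j ≤ r then b ⟨j, Finset.mem_Iic.2 hj⟩ else h.root i, ?_⟩
    ext ⟨j, hj⟩
    simp [frestrictLe, Finset.mem_Iic.1 hj]
  rw [Measure.map_apply (measurable_frestrictLe r) (measurableSet_singleton _),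
    Measure.map_apply (measurable_frestrictLe r) (measurableSet_singleton _),
    ← SimpleGraph.pathCylinder_eq_preimage,
    Measure.map_apply hm (SimpleGraph.measurableSet_pathCylinder b r),
    ← H.walkLaw_pathCylinder i b le_rfl]
  rfl

end IsBallIso

end RootedGraph

/-! ### Coincidence patterns, which carry walk events on varying vertex sets to one fixed space. -/

namespace RootedGraph

open Preorder

variable {k : ℕ}

/-- The positions of two trajectories and the roots, as a single family of vertices. -/
def positions (g : RootedGraph k) (p : (ℕ → g.V) × (ℕ → g.V)) : ℕ ⊕ ℕ ⊕ Fin k → g.V :=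
  Sum.elim p.1 (Sum.elim p.2 g.root)

/-- The pattern of coincidences among the positions of two trajectories and the roots. -/
def coincidences (g : RootedGraph k) (p : (ℕ → g.V) × (ℕ → g.V)) :
    (ℕ ⊕ ℕ ⊕ Fin k) × (ℕ ⊕ ℕ ⊕ Fin k) → Prop :=
  fun a ↦ g.positions p a.1 = g.positions p a.2

/-- The time attached to an entry of `positions`. -/
def timeOf : ℕ ⊕ ℕ ⊕ Fin k → ℕ := Sum.elim id (Sum.elim id fun _ ↦ 0)

theorem measurable_positions (g : RootedGraph k) (a : ℕ ⊕ ℕ ⊕ Fin k) :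
    Measurable fun p ↦ g.positions p a := by
  rcases a with i | i | i
  · exact (measurable_pi_apply i).comp measurable_fst
  · exact (measurable_pi_apply i).comp measurable_snd
  · exact measurable_const

theorem measurable_coincidences (g : RootedGraph k) : Measurable g.coincidences :=
  measurable_pi_lambda _ fun a ↦
    (Measurable.of_discrete (f := fun q : g.V × g.V ↦ q.1 = q.2)).comp (g := fun q : g.V × g.V ↦ q.1 = q.2)
    ((g.measurable_positions a.1).prodMk (g.measurable_positions a.2))

/-- The law of the pattern of coincidences of two independent walks started at the first root. -/
noncomputable def coincidenceLaw (g : RootedGraph (k + 1)) :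
    Measure ((ℕ ⊕ ℕ ⊕ Fin (k + 1)) × (ℕ ⊕ ℕ ⊕ Fin (k + 1)) → Prop) :=
  ((g.graph.walkLaw (g.root 0)).prod (g.graph.walkLaw (g.root 0))).map g.coincidences

instance (g : RootedGraph (k + 1)) : IsProbabilityMeasure g.coincidenceLaw :=
  Measure.isProbabilityMeasure_map g.measurable_coincidences.aemeasurable

theorem coincidenceLaw_iso {g h : RootedGraph (k + 1)} (H : IsIso g h) :
    g.coincidenceLaw = h.coincidenceLaw := by
  obtain ⟨φ, hφ⟩ := H
  have hm := (SimpleGraph.isoTrajectory φ).measurable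
  rw [coincidenceLaw, coincidenceLaw, ← hφ 0, SimpleGraph.walkLaw_iso',
    Measure.map_prod_map _ _ hm hm, Measure.map_map h.measurable_coincidences (hm.prodMap hm)]
  congr 1
  ext p a
  have hpos (a : ℕ ⊕ ℕ ⊕ Fin (k + 1)) : h.positions (Prod.map (SimpleGraph.isoTrajectory φ)
      (SimpleGraph.isoTrajectory φ) p) a = φ (g.positions p a) := by
    rcases a with i | i | i
    · rfl
    · rfl
    · exact (hφ i).symm
  simp only [coincidences, Function.comp, hpos, φ.injective.eq_iff]

theorem IsBallIso.coincidenceLaw_cylinder {r : ℕ} {g h : RootedGraph (k + 1)} {ψ : g.V → h.V}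
    (H : IsBallIso r g h ψ) {s : Finset ((ℕ ⊕ ℕ ⊕ Fin (k + 1)) × (ℕ ⊕ ℕ ⊕ Fin (k + 1)))}
    (hs : ∀ a ∈ s, timeOf a.1 ≤ r ∧ timeOf a.2 ≤ r) {S : Set (s → Prop)} (hS : MeasurableSet S) :
    g.coincidenceLaw (cylinder s S) = h.coincidenceLaw (cylinder s S) := by
  set ψs : (ℕ → g.V) → (ℕ → h.V) := fun x j ↦ ψ (x j) with hψs
  have hm : Measurable ψs := measurable_pi_lambda _ fun j ↦
    (Measurable.of_discrete (f := ψ)).comp (measurable_pi_apply j)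
  have hf := measurable_frestrictLe (X := fun _ : ℕ ↦ h.V) r
  set E : Set ((ℕ → h.V) × (ℕ → h.V)) := h.coincidences ⁻¹' cylinder s S with hE
  have hEm : MeasurableSet E := h.measurable_coincidences (.cylinder s hS)
  rw [coincidenceLaw, coincidenceLaw, Measure.map_apply g.measurable_coincidences (.cylinder s hS),
    Measure.map_apply h.measurable_coincidences (.cylinder s hS), ← hE]
  have hloc (p q : (ℕ → h.V) × (ℕ → h.V)) (h1 : ∀ i ≤ r, p.1 i = q.1 i)
      (h2 : ∀ i ≤ r, p.2 i = q.2 i) (hp : p ∈ E) : q ∈ E := by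
    have hpos (a : ℕ ⊕ ℕ ⊕ Fin (k + 1)) (ha : timeOf a ≤ r) :
        h.positions p a = h.positions q a := by
      rcases a with i | i | i
      · exact h1 i ha
      · exact h2 i ha
      · rfl
    simp only [hE, Set.mem_preimage, mem_cylinder] at hp ⊢
    convert hp using 1
    ext ⟨a, ha⟩
    simp only [Finset.restrict, coincidences, hpos _ (hs a ha).1, hpos _ (hs a ha).2]
  have hEeq : E = Prod.map (frestrictLe (π := fun _ ↦ h.V) r)
      (frestrictLe (π := fun _ ↦ h.V) r) ⁻¹' (Prod.map (frestrictLe r) (frestrictLe r) '' E) := by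
    refine (Set.subset_preimage_image _ _).antisymm ?_
    rintro q ⟨p, hp, hpq⟩
    exact hloc p q (fun i hi ↦ congrFun (congrArg Prod.fst hpq) ⟨i, Finset.mem_Iic.2 hi⟩)
      (fun i hi ↦ congrFun (congrArg Prod.snd hpq) ⟨i, Finset.mem_Iic.2 hi⟩) hp
  -- Up to time `r` both walks almost surely stay in the ball of radius `r`, where `ψ` is injective
  -- and so preserves coincidences.
  have hg : g.coincidences ⁻¹' cylinder s S =ᵐ[(g.graph.walkLaw (g.root 0)).prod
      (g.graph.walkLaw (g.root 0))] Prod.map ψs ψs ⁻¹' E := by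
    have hb := H.walkLaw_mem_ball 0
    filter_upwards [Measure.quasiMeasurePreserving_fst.ae hb,
      Measure.quasiMeasurePreserving_snd.ae hb] with p hp1 hp2
    have hpos (a : ℕ ⊕ ℕ ⊕ Fin (k + 1)) : h.positions (Prod.map ψs ψs p) a =
        ψ (g.positions p a) := by
      rcases a with i | i | i
      · rfl
      · rfl
      · exact (H.map_root i).symm
    have hmem (a : ℕ ⊕ ℕ ⊕ Fin (k + 1)) (ha : timeOf a ≤ r) : g.positions p a ∈ g.ball r := by
      rcases a with i | i | i
      · exact g.ball_mono ha (hp1 i ha).1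
      · exact g.ball_mono ha (hp2 i ha).1
      · exact g.root_mem_ball r i
    change (p ∈ g.coincidences ⁻¹' cylinder s S) = (Prod.map ψs ψs p ∈ E)
    simp only [hE, Set.mem_preimage, mem_cylinder]
    congr 1
    ext ⟨a, ha⟩
    simp only [Finset.restrict, coincidences, hpos]
    exact (H.bijOn.injOn.eq_iff (hmem _ (hs a ha).1) (hmem _ (hs a ha).2)).symm
  have hdisc : MeasurableSet (Prod.map (frestrictLe (π := fun _ ↦ h.V) r)
    (frestrictLe (π := fun _ ↦ h.V) r) '' E) := .of_discrete
  rw [measure_congr hg, ← Measure.map_apply (hm.prodMap hm) hEm, ← Measure.map_prod_map _ _ hm hm,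
    hEeq, ← Measure.map_apply (hf.prodMap hf) hdisc, ← Measure.map_apply (hf.prodMap hf) hdisc,
    ← Measure.map_prod_map _ _ hf hf, ← Measure.map_prod_map _ _ hf hf,
    H.walkLaw_map_frestrictLe]

end RootedGraph

/-! ### Measurability on the space of rooted graphs. -/

namespace RootedGraphClass

open RootedGraph

variable {k : ℕ}

/-- Such a function is locally constant: every preimage is a union of basic open sets of radius `r`.
-/
theorem measurable_of_ballIso {β : Type*} [MeasurableSpace β] {f : RootedGraphClass k → β} (r : ℕ)
    (hf : ∀ g h, BallIso r g h → f (mk g) = f (mk h)) : Measurable f := by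
  intro s _
  have h : f ⁻¹' s = ⋃ g : {g : RootedGraph k // f (mk g) ∈ s}, mk '' {h | BallIso r g.1 h} := by
    ext c
    obtain ⟨g, rfl⟩ : ∃ g, mk g = c := Quotient.exists_rep c
    simp only [Set.mem_preimage, Set.mem_iUnion]
    constructor
    · exact fun hg ↦ ⟨⟨g, hg⟩, g, BallIso.refl r g, rfl⟩
    · rintro ⟨⟨g', hg'⟩, h, hh, he⟩
      rw [← he, ← hf _ _ hh]
      exact hg'
  rw [h]
  refine IsOpen.measurableSet (isOpen_iUnion fun g ↦ ?_)
  exact TopologicalSpace.isOpen_generateFrom_of_mem ⟨g.1, r, rfl⟩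

/-- The law of the pattern of coincidences of two independent walks started at the first root. -/
noncomputable def coincidenceLaw (c : RootedGraphClass (k + 1)) :
    Measure ((ℕ ⊕ ℕ ⊕ Fin (k + 1)) × (ℕ ⊕ ℕ ⊕ Fin (k + 1)) → Prop) :=
  Quotient.lift RootedGraph.coincidenceLaw (fun _ _ h ↦ coincidenceLaw_iso h) c

theorem coincidenceLaw_mk (g : RootedGraph (k + 1)) :
    coincidenceLaw (mk g) = g.coincidenceLaw := rfl

instance (c : RootedGraphClass (k + 1)) : IsProbabilityMeasure c.coincidenceLaw := by
  obtain ⟨g, rfl⟩ : ∃ g, mk g = c := Quotient.exists_rep c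
  rw [coincidenceLaw_mk]
  infer_instance

/-- Cylinder events involve finitely many times, so their probabilities depend on a ball of fixed
radius; a π-λ argument extends this to all measurable patterns. -/
theorem measurable_coincidenceLaw_apply
    {S : Set ((ℕ ⊕ ℕ ⊕ Fin (k + 1)) × (ℕ ⊕ ℕ ⊕ Fin (k + 1)) → Prop)} (hS : MeasurableSet S) :
    Measurable fun c : RootedGraphClass (k + 1) ↦ c.coincidenceLaw S := by
  refine Measure.measurable_measure.1
    (Measurable.measure_of_isPiSystem_of_isProbabilityMeasure
      (generateFrom_measurableCylinders (α := fun _ ↦ Prop)).symm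
      isPiSystem_measurableCylinders fun A hA ↦ ?_) S hS
  obtain ⟨s, S, hS, rfl⟩ := (mem_measurableCylinders _).1 hA
  refine measurable_of_ballIso (s.sup fun a ↦ max (timeOf a.1) (timeOf a.2)) fun g h H ↦ ?_
  obtain ⟨ψ, hψ⟩ := H.exists_isBallIso
  exact hψ.coincidenceLaw_cylinder (fun a ha ↦ max_le_iff.1
    (Finset.le_sup (f := fun a ↦ max (timeOf a.1) (timeOf a.2)) ha)) hS

/-- The weight by which simple random walk is reversible: the degree of the first root, or `1` if
the graph has a single vertex. -/
noncomputable def rootWeight (c : RootedGraphClass (k + 1)) : ℕ :=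
  Quotient.lift (fun g : RootedGraph (k + 1) ↦ max (g.graph.degree (g.root 0)) 1)
    (by
      rintro g h ⟨φ, hφ⟩
      rw [← hφ 0]
      exact congrArg (max · 1) (φ.degree_eq _).symm) c

theorem measurable_rootWeight : Measurable (rootWeight (k := k)) := by
  refine measurable_of_ballIso 1 fun g h H ↦ ?_
  obtain ⟨ψ, hψ⟩ := H.exists_isBallIso
  have := hψ.degree_eq one_pos (g.root_mem_ball 0 0)
    (by rw [hψ.map_root]; exact h.root_mem_ball 0 0)
  rw [hψ.map_root] at this
  change max (g.graph.degree (g.root 0)) 1 = max (h.graph.degree (h.root 0)) 1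
  rw [this]

end RootedGraphClass

namespace SimpleGraph

theorem exists_walkLaw_eval_ne_zero {V : Type*} [MeasurableSpace V] [DiscreteMeasurableSpace V]
    [Countable V] {G : SimpleGraph V} [G.LocallyFinite] (hG : G.Connected) (u v : V) :
    ∃ n, G.walkLaw u {x | x n = v} ≠ 0 := by
  obtain ⟨γ⟩ := hG.preconnected u v
  induction γ with
  | nil =>
    refine ⟨0, ?_⟩
    rw [(prob_compl_eq_zero_iff (measurableSet_eval_eq 0 _)).1 (walkLaw_start G _)]
    exact one_ne_zero
  | @cons u w v hadj _ ih =>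
    obtain ⟨n, hn⟩ := ih
    refine ⟨1 + n, fun h0 ↦ ?_⟩
    have h1 := walkLaw_eval_inter_shiftBy G u w 1 (measurableSet_eval_eq n v)
    have hsub : {x | x 1 = w} ∩ shiftBy 1 ⁻¹' {x | x n = v} ⊆ {x | x (1 + n) = v} :=
      fun x hx ↦ hx.2
    rw [measure_mono_null hsub h0, walkLaw_one] at h1
    exact mul_ne_zero (stepLaw_ne_zero G hadj) hn h1.symm

end SimpleGraph

/-! ### The two mass transports. -/

namespace RootedGraphClass

open RootedGraph SimpleGraph

variable {k : ℕ}

/-- The patterns of coincidences for which the last meeting of the two trajectories, both considered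
from time `n` on, happens at the position `t`, at the times `i` and `j`. -/
def lastMeetingPattern (n i j : ℕ) (t : ℕ ⊕ ℕ ⊕ Fin k) :
    Set ((ℕ ⊕ ℕ ⊕ Fin k) × (ℕ ⊕ ℕ ⊕ Fin k) → Prop) :=
  {Q | Q (.inl i, t) ∧ Q (.inr (.inl j), t) ∧
    (∀ k > j, ∀ l ≥ n, ¬ Q (.inr (.inl k), .inl l)) ∧ ∀ l > i, ¬ Q (.inl l, t)}

theorem measurableSet_lastMeetingPattern (n i j : ℕ) (t : ℕ ⊕ ℕ ⊕ Fin k) :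
    MeasurableSet (lastMeetingPattern n i j t) :=
  measurableSet_setOfPred.2 <| (measurable_pi_apply _).and <| (measurable_pi_apply _).and <|
    .and (.forall fun _ ↦ .forall fun _ ↦ .forall fun _ ↦ .forall fun _ ↦
      (measurable_pi_apply _).not)
      (.forall fun _ ↦ .forall fun _ ↦ (measurable_pi_apply _).not)

theorem coincidences_mem_lastMeetingPattern_zero (g : RootedGraph k)
    (p : (ℕ → g.V) × (ℕ → g.V)) (i j : ℕ) (t : ℕ ⊕ ℕ ⊕ Fin k) :
    g.coincidences p ∈ lastMeetingPattern 0 i j t ↔ p ∈ lastMeetingAt i j (g.positions p t) := by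
  refine and_congr Iff.rfl (and_congr Iff.rfl (and_congr ?_ Iff.rfl))
  exact ⟨fun h k hk l ↦ h k hk l (Nat.zero_le l), fun h k hk l _ ↦ h k hk l⟩

theorem coincidences_mem_lastMeetingPattern_self (g : RootedGraph k)
    (p : (ℕ → g.V) × (ℕ → g.V)) (n : ℕ) (t : ℕ ⊕ ℕ ⊕ Fin k) :
    g.coincidences p ∈ lastMeetingPattern n n n t ↔
      (p.1 n = g.positions p t ∧ p.2 n = g.positions p t) ∧
        (shiftBy n p.1, shiftBy n p.2) ∈ lastMeetingAt 0 0 (g.positions p t) := by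
  constructor
  · rintro ⟨h1, h2, h3, h4⟩
    exact ⟨⟨h1, h2⟩, h1, h2, fun k hk l ↦ h3 (n + k) (by lia) (n + l) (by lia),
      fun l hl ↦ h4 (n + l) (by lia)⟩
  · rintro ⟨⟨h1, h2⟩, -, -, h3, h4⟩
    refine ⟨h1, h2, fun k hk l hl ↦ ?_, fun l hl ↦ ?_⟩
    · have := h3 (k - n) (by lia) (l - n)
      simp only [shiftBy] at this
      rwa [Nat.add_sub_cancel' (by lia), Nat.add_sub_cancel' hl] at this
    · have := h4 (l - n) (by lia)
      simp only [shiftBy] at this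
      rwa [Nat.add_sub_cancel' (by lia)] at this

theorem coincidenceLaw_mk_apply (g : RootedGraph (k + 1))
    {S : Set ((ℕ ⊕ ℕ ⊕ Fin (k + 1)) × (ℕ ⊕ ℕ ⊕ Fin (k + 1)) → Prop)} (hS : MeasurableSet S) :
    coincidenceLaw (mk g) S =
      (g.graph.walkLaw (g.root 0)).prod (g.graph.walkLaw (g.root 0)) (g.coincidences ⁻¹' S) :=
  Measure.map_apply g.measurable_coincidences hS

theorem coincidenceLaw_lastMeetingPattern_root (g : RootedGraph 1) :
    coincidenceLaw (mk g) (lastMeetingPattern 0 0 0 (.inr (.inr 0))) =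
      (g.graph.walkLaw (g.root 0)).prod (g.graph.walkLaw (g.root 0))
        (lastMeetingAt 0 0 (g.root 0)) := by
  rw [coincidenceLaw_mk_apply g (measurableSet_lastMeetingPattern _ _ _ _)]
  congr 1
  ext p
  exact coincidences_mem_lastMeetingPattern_zero g p 0 0 _

/-- The mass sent from the starting point of two walks to the place of their last meeting. -/
noncomputable def lastMeetingTransport (c : RootedGraphClass 2) : ℝ≥0 :=
  (c.rootWeight : ℝ≥0) ^ 2 *
    (c.coincidenceLaw (⋃ p : ℕ × ℕ, lastMeetingPattern 0 p.1 p.2 (.inr (.inr 1)))).toNNReal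

theorem measurable_lastMeetingTransport : Measurable lastMeetingTransport := by
  refine .mul ((measurable_from_top.comp measurable_rootWeight).pow_const 2)
    (measurable_coincidenceLaw_apply (.iUnion fun p ↦ ?_)).ennreal_toNNReal
  exact measurableSet_lastMeetingPattern _ _ _ _

theorem lastMeetingTransport_mk (g : RootedGraph 1) (u v : g.V) :
    (lastMeetingTransport (mk (g.reroot ![u, v])) : ℝ≥0∞) =
      ((max (g.graph.degree u) 1 : ℕ) : ℝ≥0∞) ^ 2 *
        (g.graph.walkLaw u).prod (g.graph.walkLaw u)
          (⋃ p : ℕ × ℕ, lastMeetingAt p.1 p.2 v) := by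
  rw [lastMeetingTransport, ENNReal.coe_mul, ENNReal.coe_toNNReal (measure_ne_top _ _),
    coincidenceLaw_mk_apply _ (.iUnion fun p ↦ measurableSet_lastMeetingPattern _ _ _ _)]
  refine congrArg₂ (· * ·) ?_ ?_
  · push_cast
    rfl
  · change (g.graph.walkLaw u).prod (g.graph.walkLaw u) _ = _
    congr 1
    ext p
    exact Set.mem_iUnion.trans ((exists_congr fun q : ℕ × ℕ ↦
      coincidences_mem_lastMeetingPattern_zero (g.reroot ![u, v]) p q.1 q.2 _).trans
        Set.mem_iUnion.symm)

theorem massSent_lastMeetingTransport_le (c : RootedGraphClass 1) :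
    c.massSent lastMeetingTransport ≤ (c.rootDegree : ℝ≥0∞) ^ 2 + 1 := by
  obtain ⟨g, rfl⟩ : ∃ g, mk g = c := Quotient.exists_rep c
  change ∑' v : g.V, (lastMeetingTransport (mk (g.reroot ![g.root 0, v])) : ℝ≥0∞) ≤
    (g.graph.degree (g.root 0) : ℝ≥0∞) ^ 2 + 1
  simp only [lastMeetingTransport_mk, ENNReal.tsum_mul_left]
  have hd : Pairwise (Function.onFun Disjoint fun v : g.V ↦
      ⋃ p : ℕ × ℕ, lastMeetingAt p.1 p.2 v) := by
    intro v w hvw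
    simp only [Function.onFun, Set.disjoint_iUnion_left, Set.disjoint_iUnion_right]
    exact fun p q ↦ pairwise_disjoint_lastMeetingAt (i := (q, v)) (j := (p, w))
      fun h ↦ hvw (congrArg Prod.snd h)
  rw [← measure_iUnion hd fun v ↦ .iUnion fun p ↦ measurableSet_lastMeetingAt p.1 p.2 v]
  refine (mul_le_of_le_one_right' prob_le_one).trans ?_
  -- The summand `1` absorbs the case in which the weight is not the degree.
  rcases le_total (g.graph.degree (g.root 0)) 1 with h | h
  · rw [max_eq_right h]
    simp
  · rw [max_eq_left h]
    exact le_self_add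

theorem massReceived_lastMeetingTransport {c : RootedGraphClass 1}
    (hc : c.HasInfiniteExpectedIntersections)
    (h : c.coincidenceLaw (lastMeetingPattern 0 0 0 (.inr (.inr 0))) ≠ 0) :
    c.massReceived lastMeetingTransport = ∞ := by
  obtain ⟨g, rfl⟩ : ∃ g, mk g = c := Quotient.exists_rep c
  change ∑' v : g.V, (lastMeetingTransport (mk (g.reroot ![v, g.root 0])) : ℝ≥0∞) = ∞
  simp only [lastMeetingTransport_mk]
  rw [coincidenceLaw_lastMeetingPattern_root] at h
  exact tsum_sq_mul_prod_walkLaw_lastMeetingAt_eq_top g.graph (g.root 0) hc h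

/-- The mass sent from the starting point of two walks to their common position at time `n`, if they
do not meet later. -/
noncomputable def meetingTransport (n : ℕ) (c : RootedGraphClass 2) : ℝ≥0 :=
  (c.coincidenceLaw (lastMeetingPattern n n n (.inr (.inr 1)))).toNNReal

theorem measurable_meetingTransport (n : ℕ) : Measurable (meetingTransport n) :=
  (measurable_coincidenceLaw_apply (measurableSet_lastMeetingPattern _ _ _ _)).ennreal_toNNReal

theorem meetingTransport_mk (n : ℕ) (g : RootedGraph 1) (u v : g.V) :
    (meetingTransport n (mk (g.reroot ![u, v])) : ℝ≥0∞) =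
      (g.graph.walkLaw u).prod (g.graph.walkLaw u)
        {p | (p.1 n = v ∧ p.2 n = v) ∧ (shiftBy n p.1, shiftBy n p.2) ∈ lastMeetingAt 0 0 v} := by
  rw [meetingTransport, ENNReal.coe_toNNReal (measure_ne_top _ _),
    coincidenceLaw_mk_apply _ (measurableSet_lastMeetingPattern _ _ _ _)]
  change (g.graph.walkLaw u).prod (g.graph.walkLaw u) _ = _
  congr 1
  ext p
  exact coincidences_mem_lastMeetingPattern_self (g.reroot ![u, v]) p n _

/-- By the Markov property at time `n`, the mass from `u` to `v` is the squared `n`-step probability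
times the probability that makes `v` bad. -/
theorem massReceived_meetingTransport (n : ℕ) {c : RootedGraphClass 1}
    (h : c.coincidenceLaw (lastMeetingPattern 0 0 0 (.inr (.inr 0))) = 0) :
    c.massReceived (meetingTransport n) = 0 := by
  obtain ⟨g, rfl⟩ : ∃ g, mk g = c := Quotient.exists_rep c
  change ∑' v : g.V, (meetingTransport n (mk (g.reroot ![v, g.root 0])) : ℝ≥0∞) = 0
  rw [coincidenceLaw_lastMeetingPattern_root] at h
  rw [ENNReal.tsum_eq_zero]
  intro v
  rw [meetingTransport_mk, prod_walkLaw_shiftBy _ _ _ _ _ _ _ (measurableSet_lastMeetingAt _ _ _),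
    h, mul_zero]

/-- Summing over `v` partitions by the position of the first walk at time `n`, so the target `.inl
n` replaces the second root. -/
theorem massSent_meetingTransport (n : ℕ) (c : RootedGraphClass 1) :
    c.massSent (meetingTransport n) =
      c.coincidenceLaw (lastMeetingPattern n n n (.inl n)) := by
  obtain ⟨g, rfl⟩ : ∃ g, mk g = c := Quotient.exists_rep c
  change ∑' v : g.V, (meetingTransport n (mk (g.reroot ![g.root 0, v])) : ℝ≥0∞) = _
  rw [coincidenceLaw_mk_apply _ (measurableSet_lastMeetingPattern _ _ _ _),
    measure_eq_tsum_inter_preimage _ ((measurable_pi_apply n).comp measurable_fst)]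
  refine tsum_congr fun v ↦ ?_
  rw [meetingTransport_mk]
  congr 1
  ext p
  simp only [Set.mem_inter_iff, Set.mem_preimage, coincidences_mem_lastMeetingPattern_self]
  constructor
  · rintro ⟨⟨rfl, h2⟩, h⟩
    exact ⟨⟨⟨rfl, h2⟩, h⟩, rfl⟩
  · rintro ⟨h, rfl⟩
    exact h

/-- Every vertex is reached from the root with positive probability at some time `n`, so a bad
vertex would make the probability for that `n` positive. -/
theorem hasInfiniteIntersectionProperty_of_coincidenceLaw {c : RootedGraphClass 1}
    (h : ∀ n, c.coincidenceLaw (lastMeetingPattern n n n (.inl n)) = 0) :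
    c.HasInfiniteIntersectionProperty := by
  obtain ⟨g, rfl⟩ : ∃ g, mk g = c := Quotient.exists_rep c
  refine hasInfiniteIntersectionProperty_of_lastMeetingAt g.connected fun v ↦ ?_
  obtain ⟨n, hn⟩ := exists_walkLaw_eval_ne_zero g.connected (g.root 0) v
  have h0 := h n
  rw [← massSent_meetingTransport] at h0
  have hv := ENNReal.tsum_eq_zero.1 h0 v
  rw [meetingTransport_mk, prod_walkLaw_shiftBy _ _ _ _ _ _ _
    (measurableSet_lastMeetingAt _ _ _)] at hv
  exact (mul_eq_zero.1 hv).resolve_left (mul_ne_zero hn hn)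

end RootedGraphClass

-- The infinite mass received at a bad root is integrated against the second-moment bound on the
-- mass sent.
open RootedGraphClass in
theorem IsUnimodular.ae_coincidenceLaw_eq_zero {Ω : Type*} [MeasurableSpace Ω] {P : Measure Ω}
    [IsProbabilityMeasure P] {G : Ω → RootedGraphClass 1} (hG : Measurable G)
    (hunimod : IsUnimodular P G) (hdeg : ∫⁻ ω, ((G ω).rootDegree : ℝ≥0∞) ^ 2 ∂P < ∞)
    (hinter : ∀ᵐ ω ∂P, (G ω).HasInfiniteExpectedIntersections) :
    ∀ᵐ ω ∂P, (G ω).coincidenceLaw (lastMeetingPattern 0 0 0 (.inr (.inr 0))) = 0 := by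
  have hm : MeasurableSet
      {ω | (G ω).coincidenceLaw (lastMeetingPattern 0 0 0 (.inr (.inr 0))) ≠ 0} :=
    ((measurable_coincidenceLaw_apply (measurableSet_lastMeetingPattern _ _ _ _)).comp hG)
      (measurableSet_singleton 0).compl
  have hle : ∞ * P {ω | (G ω).coincidenceLaw (lastMeetingPattern 0 0 0 (.inr (.inr 0))) ≠ 0} ≤
      ∫⁻ ω, ((G ω).rootDegree : ℝ≥0∞) ^ 2 ∂P + 1 := by
    rw [← lintegral_indicator_const hm]
    calc ∫⁻ ω, {ω | (G ω).coincidenceLaw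
            (lastMeetingPattern 0 0 0 (.inr (.inr 0))) ≠ 0}.indicator (fun _ ↦ ∞) ω ∂P
        ≤ ∫⁻ ω, (G ω).massReceived lastMeetingTransport ∂P := by
          refine lintegral_mono_ae ?_
          filter_upwards [hinter] with ω hω
          by_cases h0 : (G ω).coincidenceLaw (lastMeetingPattern 0 0 0 (.inr (.inr 0))) = 0
          · rw [Set.indicator_of_notMem (by simpa using h0)]
            exact bot_le
          · rw [massReceived_lastMeetingTransport hω h0]
            exact le_top
      _ = ∫⁻ ω, (G ω).massSent lastMeetingTransport ∂P :=
          (hunimod _ measurable_lastMeetingTransport).symm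
      _ ≤ ∫⁻ ω, (((G ω).rootDegree : ℝ≥0∞) ^ 2 + 1) ∂P :=
          lintegral_mono fun ω ↦ massSent_lastMeetingTransport_le (G ω)
      _ = _ := by
          rw [lintegral_add_right _ measurable_const]
          simp
  by_contra hne
  rw [ae_iff] at hne
  rw [ENNReal.top_mul hne] at hle
  exact (ENNReal.add_lt_top.2 ⟨hdeg, ENNReal.one_lt_top⟩).not_ge hle

theorem mainTheorem7 {Ω : Type*} [MeasurableSpace Ω] (P : Measure Ω) [IsProbabilityMeasure P]
    (G : Ω → RootedGraphClass 1) (hG : Measurable G) (hunimod : IsUnimodular P G)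
    (hdeg : ∫⁻ ω, ((G ω).rootDegree : ℝ≥0∞) ^ 2 ∂P < ∞)
    (hinter : ∀ᵐ ω ∂P, (G ω).HasInfiniteExpectedIntersections) :
    ∀ᵐ ω ∂P, (G ω).HasInfiniteIntersectionProperty := by
  have h0 := hunimod.ae_coincidenceLaw_eq_zero hG hdeg hinter
  have h (n : ℕ) : ∀ᵐ ω ∂P, (G ω).coincidenceLaw
      (RootedGraphClass.lastMeetingPattern n n n (.inl n)) = 0 := by
    have hm := (RootedGraphClass.measurable_coincidenceLaw_apply (k := 0)
      (RootedGraphClass.measurableSet_lastMeetingPattern n n n (.inl n))).comp hG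
    refine (lintegral_eq_zero_iff hm).1 ?_
    -- The expected mass sent equals the expected mass received, which is zero because the root is
    -- almost surely not bad.
    simp only [Function.comp, ← RootedGraphClass.massSent_meetingTransport]
    rw [hunimod _ (RootedGraphClass.measurable_meetingTransport n)]
    refine (lintegral_congr_ae ?_).trans lintegral_zero
    filter_upwards [h0] with ω hω
    exact RootedGraphClass.massReceived_meetingTransport n hω
  filter_upwards [ae_all_iff.2 h] with ω hω
  exact RootedGraphClass.hasInfiniteIntersectionProperty_of_coincidenceLaw hω
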